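/- Let $G$ be a group. A $G$-tree is a (nonempty) tree with an action of $G$ by graph automorphisms, without inversions. A generalized Baumslag--Solitar (GBS) tree with group $G$ is a $G$-tree all of whose vertex and edge stabilizers are infinite cyclic. A $G$-tree is cocompact if its quotient graph is finite; it is elementary if there is a $G$-invariant point or a $G$-invariant line, and non-elementary otherwise; it is fully reduced if no vertex stabilizer contains the stabilizer of a vertex from a different $G$-orbit (that is, whenever $G_v \subseteq G_w$ for vertices $v,w$, one has $w = gv$ for some $g \in G$). Theorem. Let $X$ be a non-elementary cocompact GBS tree with group $G$. Then $X$ is fully reduced if and only if it has the smallest number of edge orbits among all GBS trees with group $G$, that is, if and only if for every GBS tree $Y$ with group $G$ the number of $G$-orbits of edges of $X$ is at most the (possibly infinite) number of $G$-orbits of edges of $Y$. Moreover, any two fully reduced GBS trees with group $G$ have the same number of edge orbits. -/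

import Mathlib

universe u

/-- A `G`-tree: a tree with an action of `G` by graph automorphisms, without inversions.
Since a tree has neither loops nor multiple edges, it is given by its vertex set and the
adjacency relation; an (unoriented) edge is an element of `graph.edgeSet`. -/
structure GTree (G : Type u) [Group G] where
  /-- the set of vertices -/
  V : Type u
  /-- the underlying tree -/
  graph : SimpleGraph V
  isTree : graph.IsTree
  /-- the action of `G` on the vertices -/
  action : MulAction G V
  adj_smul : ∀ (g : G) (v w : V), graph.Adj v w → graph.Adj (g • v) (g • w)
  no_inversion : ∀ (g : G) (v w : V), graph.Adj v w → ¬ (g • v = w ∧ g • w = v)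

attribute [instance] GTree.action

namespace GTree

variable {G : Type u} [Group G] (X : GTree G)

/-- The stabilizer of a vertex. -/
def vertexStabilizer (v : X.V) : Subgroup G := MulAction.stabilizer G v

/-- The stabilizer of the edge with endpoints `v` and `w`. As there are no inversions, an element
that preserves the edge fixes both of its endpoints. -/
def edgeStabilizer (v w : X.V) : Subgroup G := X.vertexStabilizer v ⊓ X.vertexStabilizer w

/-- Two (unoriented) edges are equivalent if some element of `G` takes one to the other. -/
def edgeSetoid : Setoid X.graph.edgeSet where
  r e f := ∃ g : G, Sym2.map (fun v => g • v) (e : Sym2 X.V) = f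
  iseqv :=
    { refl := fun e => ⟨1, by simp⟩
      symm := by
        rintro e f ⟨g, hg⟩
        refine ⟨g⁻¹, ?_⟩
        rw [← hg, Sym2.map_map]
        simp
      trans := by
        rintro e f k ⟨g, hg⟩ ⟨h, hh⟩
        refine ⟨h * g, ?_⟩
        rw [← hh, ← hg, Sym2.map_map]
        simp [mul_smul] }

/-- The set of vertex orbits, that is, the set of vertices of the quotient graph. -/
def VertexOrbits : Type u := MulAction.orbitRel.Quotient G X.V

/-- The set of (unoriented) edge orbits, that is, the set of edges of the quotient graph. -/
def EdgeOrbits : Type u := Quotient X.edgeSetoid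

/-- The number of edge orbits, `⊤` if it is infinite. -/
noncomputable def numEdgeOrbits : ℕ∞ := ENat.card X.EdgeOrbits

/-- A `G`-tree is cocompact if the quotient graph is finite. -/
def IsCocompact : Prop := Finite X.VertexOrbits ∧ Finite X.EdgeOrbits

/-- A generalized Baumslag-Solitar tree: all vertex and edge stabilizers are infinite cyclic. -/
def IsGBS : Prop :=
  (∀ v : X.V, IsCyclic (X.vertexStabilizer v) ∧ Infinite (X.vertexStabilizer v)) ∧
  (∀ v w : X.V, X.graph.Adj v w →
    IsCyclic (X.edgeStabilizer v w) ∧ Infinite (X.edgeStabilizer v w))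

/-- There is a `G`-invariant point. As there are no inversions, it can be taken to be a vertex. -/
def HasInvariantPoint : Prop := ∃ v : X.V, ∀ g : G, g • v = v

/-- There is a `G`-invariant line, that is, a bi-infinite embedded edge path `ℓ` whose image is
preserved by `G`. -/
def HasInvariantLine : Prop :=
  ∃ ℓ : ℤ → X.V, Function.Injective ℓ ∧ (∀ n : ℤ, X.graph.Adj (ℓ n) (ℓ (n + 1))) ∧
    ∀ (g : G) (n : ℤ), ∃ m : ℤ, g • ℓ n = ℓ m

/-- A `G`-tree is elementary if there is a `G`-invariant point or line. -/
def IsElementary : Prop := X.HasInvariantPoint ∨ X.HasInvariantLine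

/-- A `G`-tree is fully reduced if no vertex stabilizer contains the stabilizer of a vertex from a
different orbit. -/
def IsFullyReduced : Prop :=
  ∀ v w : X.V, X.vertexStabilizer v ≤ X.vertexStabilizer w → ∃ g : G, g • v = w

end GTree

/-! Fully reduced implies minimal. Let `X` be the given non-elementary tree and `b` a generator of a
vertex stabilizer of another GBS tree. If `b` fixed no vertex of `X`, it would have an axis. Every
conjugate of `b` shares a nontrivial power with `b`, so every translate of the axis would lie in the
axis, which would then be an invariant line. Hence `b` is elliptic in `X`
(`IsGBS.exists_vertexStabilizer_le`), and commensurability gives the reverse direction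
(`IsGBS.exists_vertexStabilizer_le'`): all GBS trees with group `G` have the same elliptic
subgroups. Cohomology modulo 2 yields E + 1 = d + V, where E and V count edge and vertex orbits and
d is the dimension of the space of homomorphisms from `G` to `ZMod 2` that vanish on vertex
stabilizers (`card_edgeOrbits_add_one`). As d is the same for all these trees, comparing E amounts
to comparing V, and the vertex orbits of a fully reduced tree inject into those of any other one
(`IsFullyReduced.exists_injective`).

Minimal implies fully reduced. Suppose G_v ≤ G_w with `w` outside the orbit of `v`. Then G_v fixes
the path from `v` to `w`. If the first edge leaves the orbit of `v`, collapsing it saves an edge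
orbit. Otherwise it is an ascending loop: s⁻¹cs = c^N, where `c` generates G_v. Folding along this
loop enlarges the stabilizer of `v`. An edge at `v` whose stabilizer has index dividing a power of N
can afterwards be slid to a translate of `v` with exactly the stabilizer of that edge. Following the
path to `w`, this produces either a collapsible edge or a longer ascending loop whose exponent has
all the primes of N and a new one (`BadLoop.exists_improved`). Primes cannot be gained forever: the
relation s⁻¹cs = c^N, read in the original tree, forces each prime of N to divide a fixed integer
(`dvd_of_inv_conj_eq_zpow`).

Modified graphs are shown to be acyclic by means of functions to `ZMod 2`: every function on the
edges of a tree is a coboundary, and a graph is acyclic once each edge is the only one crossed by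
some function. -/

namespace SimpleGraph

/-! ### Potentials modulo 2 on trees. -/

variable {V : Type*}

theorem zmod_two_add_self (a : ZMod 2) : a + a = 0 := CharTwo.add_self_eq_zero a

/-- In a tree every `ZMod 2`-valued function on edges is the coboundary of a function on vertices. -/
theorem IsTree.exists_potential {T : SimpleGraph V} (hT : T.IsTree) (c : Sym2 V → ZMod 2) :
    ∃ χ : V → ZMod 2, ∀ x y, T.Adj x y → χ x + χ y = c s(x, y) := by
  classical
  obtain ⟨r⟩ := hT.connected.nonempty
  choose p hp hu using fun v => hT.existsUnique_path r v
  have key : ∀ x y, T.Adj x y → y ∉ (p x).support →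
      ((p x).edges.map c).sum + ((p y).edges.map c).sum = c s(x, y) := by
    intro x y h hy
    have : (p x).concat h = p y := hu y _ ((hp x).concat hy h)
    rw [← this, Walk.edges_concat, List.concat_eq_append, List.map_append, List.sum_append,
      ← add_assoc, zmod_two_add_self]
    simp
  refine ⟨fun v => ((p v).edges.map c).sum, fun x y h => ?_⟩
  by_cases hy : y ∈ (p x).support
  · have hx := hT.isAcyclic.ne_mem_support_of_support_of_adj_of_isPath (hp x) (hp y) h hy
    have := key y x h.symm hx
    rw [add_comm, this, Sym2.eq_swap]
  · exact key x y h hy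

/-- A graph is acyclic if each edge is the only one across which some function changes. -/
theorem isAcyclic_of_potential {H : SimpleGraph V}
    (h : ∀ x y, H.Adj x y → ∃ χ : V → ZMod 2, χ x ≠ χ y ∧
      ∀ a b, H.Adj a b → s(a, b) ≠ s(x, y) → χ a = χ b) : H.IsAcyclic := by
  rw [isAcyclic_iff_forall_adj_isBridge]
  intro x y hxy
  obtain ⟨χ, h1, h2⟩ := h x y hxy
  rw [isBridge_iff]
  rintro hr
  apply h1
  obtain ⟨p⟩ := hr
  have : ∀ a b, (H \ fromEdgeSet {s(x, y)}).Walk a b → χ a = χ b := by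
    intro a b p
    induction p with
    | nil => rfl
    | cons hadj p ih =>
      rw [← ih]
      rw [sdiff_adj] at hadj
      refine h2 _ _ hadj.1 fun he => hadj.2 ?_
      rw [fromEdgeSet_adj]
      exact ⟨he, hadj.1.ne⟩
  exact this _ _ p

end SimpleGraph

theorem SimpleGraph.Reachable.apply_eq {V α : Type*} {H : SimpleGraph V} {χ : V → α}
    (hχ : ∀ x y, H.Adj x y → χ x = χ y) {x y : V} (h : H.Reachable x y) : χ x = χ y := by
  obtain ⟨p⟩ := h
  induction p with
  | nil => rfl
  | cons hadj p ih => rw [← ih]; exact hχ _ _ hadj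

/-! ### Fixed points, separating functions and counting of edge orbits. -/

namespace GTree

variable {G : Type u} [Group G] (X : GTree G)

theorem adj_smul_iff (g : G) (v w : X.V) : X.graph.Adj (g • v) (g • w) ↔ X.graph.Adj v w := by
  refine ⟨fun h => ?_, X.adj_smul g v w⟩
  simpa using X.adj_smul g⁻¹ _ _ h

theorem mem_vertexStabilizer {g : G} {v : X.V} : g ∈ X.vertexStabilizer v ↔ g • v = v := Iff.rfl

theorem mem_vertexStabilizer_smul {g h : G} {v : X.V} :
    h ∈ X.vertexStabilizer (g • v) ↔ g⁻¹ * h * g ∈ X.vertexStabilizer v := by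
  rw [mem_vertexStabilizer, mem_vertexStabilizer, mul_smul, mul_smul, inv_smul_eq_iff]

theorem edgeStabilizer_comm (v w : X.V) : X.edgeStabilizer v w = X.edgeStabilizer w v :=
  inf_comm _ _

/-- The action of a group element as a graph homomorphism. -/
def smulHom (g : G) : X.graph →g X.graph where
  toFun v := g • v
  map_rel' h := X.adj_smul g _ _ h

theorem mem_edgeStabilizer_of_mk_eq {a b : X.V} (hab : X.graph.Adj a b) {g : G}
    (h : s(g • a, g • b) = s(a, b)) : g ∈ X.edgeStabilizer a b := by
  rw [Sym2.eq_iff] at h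
  rcases h with h | h
  · exact h
  · exact absurd h (X.no_inversion g a b hab)

/-- If the square of an element fixes a vertex, so does the element. -/
theorem exists_fixed_of_smul_smul {g : G} {x : X.V} (h : g • g • x = x) : ∃ y : X.V, g • y = y := by
  obtain ⟨p, hp, hu⟩ := X.isTree.existsUnique_path x (g • x)
  have hex : ∀ z, g • g • x = z → ∃ q : X.graph.Walk (g • x) z, q.IsPath ∧
      q.length = p.length ∧ ∀ i, q.getVert i = g • p.getVert i := by
    rintro z rfl
    exact ⟨p.map (X.smulHom g), hp.map (f := X.smulHom g) (MulAction.injective g),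
      p.length_map _, fun i => p.getVert_map _ i⟩
  obtain ⟨q, hq, hql, hqv⟩ := hex x h
  have hpq := hu q.reverse hq.reverse
  -- By uniqueness of paths, `g` carries the path from `x` to `g • x` onto its reverse. For even
  -- length the midpoint is fixed; for odd length the middle edge would be inverted.
  have hv : ∀ i, p.getVert i = g • p.getVert (p.length - i) := by
    intro i
    conv_lhs => rw [← hpq]
    rw [SimpleGraph.Walk.getVert_reverse, hqv, hql]
  rcases Nat.even_or_odd' p.length with ⟨j, hj | hj⟩
  · refine ⟨p.getVert j, ?_⟩
    have := hv j
    rw [hj, show 2 * j - j = j by omega] at this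
    exact this.symm
  · exfalso
    refine X.no_inversion g (p.getVert j) (p.getVert (j + 1))
      (p.adj_getVert_succ (by omega)) ⟨?_, ?_⟩
    · have := hv (j + 1)
      rw [hj, show 2 * j + 1 - (j + 1) = j by omega] at this
      exact this.symm
    · have := hv j
      rw [hj, show 2 * j + 1 - j = j + 1 by omega] at this
      exact this.symm

/-- An action on a tree has no inversions if its elliptic elements are elliptic in a `G`-tree that
maps to it. -/
theorem no_inversion_of_map {W : Type*} [MulAction G W] {H : SimpleGraph W} (hH : H.IsTree)
    (hadj : ∀ (g : G) (v w : W), H.Adj v w → H.Adj (g • v) (g • w)) (φ : X.V → W)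
    (hφ : ∀ (g : G) v, φ (g • v) = g • φ v)
    (hst : ∀ w : W, ∃ v : X.V, ∀ g : G, g • w = w → g • v = v)
    (g : G) (v w : W) (hvw : H.Adj v w) : ¬ (g • v = w ∧ g • w = v) := by
  rintro ⟨h1, h2⟩
  obtain ⟨x, hx⟩ := hst v
  have hgg : g • g • x = x := by
    rw [smul_smul]
    exact hx _ (by rw [← smul_smul, h1, h2])
  obtain ⟨y, hy⟩ := X.exists_fixed_of_smul_smul hgg
  have hy' : g • φ y = φ y := by rw [← hφ, hy]
  have hle : ∀ (g : G) (a b : W), H.dist (g • a) (g • b) ≤ H.dist a b := by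
    intro g a b
    obtain ⟨p, hp⟩ := hH.connected.exists_walk_length_eq_dist a b
    let f : H →g H := ⟨fun v => g • v, fun h => hadj g _ _ h⟩
    rw [← hp, ← SimpleGraph.Walk.length_map f p]
    exact SimpleGraph.dist_le _
  -- The element `g` fixes `φ y` and swaps `v` and `w`, so both would be equally far from `φ y`;
  -- adjacent vertices of a tree never are.
  apply hH.dist_ne_of_adj (φ y) hvw
  apply le_antisymm
  · have := hle g (φ y) w
    rwa [hy', h2] at this
  · have := hle g (φ y) v
    rwa [hy', h1] at this

/-- The graph obtained by removing the orbit of an edge. -/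
def cut (a b : X.V) : SimpleGraph X.V where
  Adj x y := X.graph.Adj x y ∧ ∀ g : G, s(g • a, g • b) ≠ s(x, y)
  symm := ⟨fun x y h => ⟨h.1.symm, fun g => by rw [Sym2.eq_swap (a := y)]; exact h.2 g⟩⟩
  loopless := ⟨fun x h => h.1.ne rfl⟩

theorem cut_adj_smul (a b : X.V) (g : G) {x y : X.V} (h : (X.cut a b).Adj x y) :
    (X.cut a b).Adj (g • x) (g • y) := by
  refine ⟨X.adj_smul g _ _ h.1, fun k hk => h.2 (g⁻¹ * k) ?_⟩
  have := congrArg (Sym2.map (fun v => g⁻¹ • v)) hk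
  simpa [mul_smul] using this

theorem cut_reachable_smul (a b : X.V) (g : G) {x y : X.V} (h : (X.cut a b).Reachable x y) :
    (X.cut a b).Reachable (g • x) (g • y) :=
  h.map ⟨fun v => g • v, fun h => X.cut_adj_smul a b g h⟩

/-- A function that changes exactly across one edge. -/
theorem exists_indicator (a b : X.V) : ∃ χ : X.V → ZMod 2,
    (∀ x y, X.graph.Adj x y → s(a, b) ≠ s(x, y) → χ x = χ y) ∧
    ∀ x y, X.graph.Adj x y → s(a, b) = s(x, y) → χ x + χ y = 1 := by
  classical
  obtain ⟨χ, h⟩ := X.isTree.exists_potential (fun e => if s(a, b) = e then 1 else 0)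
  refine ⟨χ, fun x y hxy hne => ?_, fun x y hxy he => by rw [h x y hxy, if_pos he]⟩
  have := h x y hxy
  rw [if_neg hne] at this
  exact CharTwo.add_eq_zero.mp this

/-- An element fixing a vertex on each side preserves the two components of the cut graph that
contain `a` and `b`. The function jumping only across (a, b) is constant on these components, so it
jumps across the translated edge, which must be the edge itself. -/
theorem mem_edgeStabilizer_of_cut_reachable {a b x y : X.V} (hab : X.graph.Adj a b)
    (hx : (X.cut a b).Reachable a x) (hy : (X.cut a b).Reachable b y) {g : G} (hgx : g • x = x)
    (hgy : g • y = y) : g ∈ X.edgeStabilizer a b := by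
  obtain ⟨χ, h1, h2⟩ := X.exists_indicator a b
  have hc : ∀ {x y}, (X.cut a b).Reachable x y → χ x = χ y := fun h =>
    h.apply_eq fun x y (hxy : (X.cut a b).Adj x y) => h1 x y hxy.1 (by simpa using hxy.2 1)
  have e1 : χ (g • a) = χ a := by
    rw [hc (X.cut_reachable_smul a b g hx), hgx, hc hx]
  have e2 : χ (g • b) = χ b := by
    rw [hc (X.cut_reachable_smul a b g hy), hgy, hc hy]
  have e3 := h2 a b hab rfl
  apply X.mem_edgeStabilizer_of_mk_eq hab
  by_contra hne
  have := h1 _ _ (X.adj_smul g _ _ hab) (Ne.symm hne)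
  rw [e1, e2] at this
  rw [this, CharTwo.add_self_eq_zero] at e3
  exact zero_ne_one e3

section Count

variable {X} {Y : GTree G}

/-- A correspondence between edges gives an injection between edge orbits. -/
theorem exists_injective_edgeOrbits (R : Sym2 X.V → Sym2 Y.V → Prop)
    (h1 : ∀ e' ∈ Y.graph.edgeSet, ∃ e ∈ X.graph.edgeSet, R e e')
    (h2 : ∀ (g : G) e e₁' e₂', R e e₁' → R (e.map (g • ·)) e₂' →
      ∃ k : G, e₁'.map (k • ·) = e₂') :
    ∃ f : Y.EdgeOrbits → X.EdgeOrbits, Function.Injective f ∧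
      ∀ o, ∃ e, ∃ e', R e.1 e' ∧ f o = Quotient.mk X.edgeSetoid e := by
  choose F hF hR using h1
  refine ⟨fun o => Quotient.mk X.edgeSetoid ⟨F o.out.1 o.out.2, hF _ _⟩, ?_, fun o =>
    ⟨_, _, hR _ o.out.2, rfl⟩⟩
  intro o₁ o₂ h
  obtain ⟨g, hg⟩ := Quotient.exact h
  obtain ⟨k, hk⟩ := h2 g _ _ _ (hR _ o₁.out.2) (by
    have := hR _ o₂.out.2
    simp only at hg
    rw [hg]
    exact this)
  rw [← Quotient.out_eq o₁, ← Quotient.out_eq o₂]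
  exact Quotient.sound ⟨k, hk⟩

theorem numEdgeOrbits_le_of_rel (R : Sym2 X.V → Sym2 Y.V → Prop)
    (h1 : ∀ e' ∈ Y.graph.edgeSet, ∃ e ∈ X.graph.edgeSet, R e e')
    (h2 : ∀ (g : G) e e₁' e₂', R e e₁' → R (e.map (g • ·)) e₂' →
      ∃ k : G, e₁'.map (k • ·) = e₂') : Y.numEdgeOrbits ≤ X.numEdgeOrbits := by
  obtain ⟨f, hf, -⟩ := exists_injective_edgeOrbits R h1 h2
  exact ENat.card_le_card_of_injective hf

theorem numEdgeOrbits_lt_of_rel [Finite X.EdgeOrbits] (R : Sym2 X.V → Sym2 Y.V → Prop)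
    (h1 : ∀ e' ∈ Y.graph.edgeSet, ∃ e ∈ X.graph.edgeSet, R e e')
    (h2 : ∀ (g : G) e e₁' e₂', R e e₁' → R (e.map (g • ·)) e₂' →
      ∃ k : G, e₁'.map (k • ·) = e₂') {a b : X.V} (hab : X.graph.Adj a b)
    (h3 : ∀ (g : G) e', ¬ R s(g • a, g • b) e') : Y.numEdgeOrbits < X.numEdgeOrbits := by
  obtain ⟨f, hf, hf'⟩ := exists_injective_edgeOrbits R h1 h2
  have : Finite Y.EdgeOrbits := Finite.of_injective f hf
  have hns : ¬ Function.Surjective f := by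
    intro hs
    obtain ⟨o, ho⟩ := hs (Quotient.mk X.edgeSetoid ⟨s(a, b), hab⟩)
    obtain ⟨e, e', hR, he⟩ := hf' o
    rw [ho] at he
    obtain ⟨g, hg⟩ := Quotient.exact he
    simp only [Sym2.map_mk] at hg
    exact h3 g e' (by simpa [← hg] using hR)
  have : Nat.card Y.EdgeOrbits < Nat.card X.EdgeOrbits := by
    refine lt_of_le_of_ne (Nat.card_le_card_of_injective f hf) fun h => hns ?_
    exact ((Nat.bijective_iff_injective_and_card f).mpr ⟨hf, h⟩).2
  unfold numEdgeOrbits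
  rw [ENat.card_eq_coe_natCard, ENat.card_eq_coe_natCard]
  exact_mod_cast this

end Count

end GTree

/-! ### Replacing an edge orbit by sliding both ends. -/

namespace GTree

variable {G : Type u} [Group G] (X : GTree G)

/-- A subgroup of a cyclic group is cyclic, and it is infinite once it contains an infinite
subgroup. Bounds from both sides by stabilizers of a GBS tree therefore suffice. -/
theorem isGBS_of_stabilizer_le {X Y : GTree G} (hX : X.IsGBS)
    (h1 : ∀ w : Y.V, ∃ v : X.V, Y.vertexStabilizer w ≤ X.vertexStabilizer v)
    (h2 : ∀ w : Y.V, ∃ v : X.V, X.vertexStabilizer v ≤ Y.vertexStabilizer w)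
    (h3 : ∀ w w' : Y.V, Y.graph.Adj w w' → ∃ v v' : X.V, X.graph.Adj v v' ∧
      X.edgeStabilizer v v' ≤ Y.edgeStabilizer w w') : Y.IsGBS := by
  have cyc : ∀ w : Y.V, ∀ H : Subgroup G, H ≤ Y.vertexStabilizer w → IsCyclic H := by
    intro w H hH
    obtain ⟨v, hv⟩ := h1 w
    have := (hX.1 v).1
    exact isCyclic_of_injective (Subgroup.inclusion (hH.trans hv))
      (Subgroup.inclusion_injective _)
  refine ⟨fun w => ⟨cyc w _ le_rfl, ?_⟩, fun w w' h => ⟨cyc w _ inf_le_left, ?_⟩⟩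
  · obtain ⟨v, hv⟩ := h2 w
    have := (hX.1 v).2
    exact Infinite.of_injective _ (Subgroup.inclusion_injective hv)
  · obtain ⟨v, v', hv, hvv⟩ := h3 w w' h
    have := (hX.2 v v' hv).2
    exact Infinite.of_injective _ (Subgroup.inclusion_injective hvv)

section Replace

variable {a b a' b' : X.V}

theorem ne_of_cut_reachable (hab : X.graph.Adj a b)
    (ha : (X.cut a b).Reachable a a') (hb : (X.cut a b).Reachable b b') : a' ≠ b' := by
  rintro rfl
  obtain ⟨χ, h1, h2⟩ := X.exists_indicator a b
  have hc : ∀ {x y}, (X.cut a b).Reachable x y → χ x = χ y := fun h =>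
    h.apply_eq fun x y (hxy : (X.cut a b).Adj x y) => h1 x y hxy.1 (by simpa using hxy.2 1)
  have := h2 a b hab rfl
  rw [hc ha, hc hb, CharTwo.add_self_eq_zero] at this
  exact zero_ne_one this

/-- Makes data attached to the edges in the orbit of (a, b) well defined: h⁻¹g fixes the edge, hence
`x`. -/
theorem smul_eq_smul_of_mk_eq (hab : X.graph.Adj a b) {x : X.V}
    (hx : X.edgeStabilizer a b ≤ X.vertexStabilizer x) {g h : G}
    (e : s(g • a, g • b) = s(h • a, h • b)) : g • x = h • x := by
  have : s((h⁻¹ * g) • a, (h⁻¹ * g) • b) = s(a, b) := by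
    have := congrArg (Sym2.map (fun v => h⁻¹ • v)) e
    simpa [mul_smul] using this
  have := hx (X.mem_edgeStabilizer_of_mk_eq hab this)
  rwa [mem_vertexStabilizer, mul_smul, inv_smul_eq_iff] at this

/-- The graph in which the orbit of the edge `(a, b)` is replaced by the orbit of `(a', b')`. -/
def replaceGraph (a b a' b' : X.V) (hne : a' ≠ b') : SimpleGraph X.V where
  Adj x y := (X.cut a b).Adj x y ∨ ∃ g : G, s(g • a', g • b') = s(x, y)
  symm := ⟨fun x y h => h.imp (fun h => h.symm) fun ⟨g, hg⟩ => ⟨g, hg.trans Sym2.eq_swap⟩⟩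
  loopless := ⟨fun x h => by
    rcases h with h | ⟨g, hg⟩
    · exact h.ne rfl
    · rw [Sym2.eq_iff] at hg
      exact hne (MulAction.injective g (by rcases hg with h | h <;> exact h.1.trans h.2.symm))⟩

/-- Connectedness: `a'` and `b'` are joined to `a` and `b` by edges that survive. Acyclicity: a kept
edge needs an indicator corrected along the removed orbit, while a new edge is detected by the
indicator of the old edge it replaces. -/
theorem replaceGraph_isTree (hab : X.graph.Adj a b)
    (ha : (X.cut a b).Reachable a a') (hb : (X.cut a b).Reachable b b')
    (hsa : X.edgeStabilizer a b ≤ X.vertexStabilizer a')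
    (hsb : X.edgeStabilizer a b ≤ X.vertexStabilizer b') (hne : a' ≠ b') :
    (X.replaceGraph a b a' b' hne).IsTree := by
  classical
  have hva : X.edgeStabilizer a b ≤ X.vertexStabilizer a := inf_le_left
  have hvb : X.edgeStabilizer a b ≤ X.vertexStabilizer b := inf_le_right
  have cutle : X.cut a b ≤ X.replaceGraph a b a' b' hne := fun x y h => Or.inl h
  have := X.isTree.connected.nonempty
  refine ⟨⟨?_⟩, SimpleGraph.isAcyclic_of_potential ?_⟩
  · have key : ∀ x y, X.graph.Adj x y → (X.replaceGraph a b a' b' hne).Reachable x y := by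
      intro x y hxy
      by_cases h : (X.cut a b).Adj x y
      · exact (cutle h).reachable
      · have : ∃ g : G, s(g • a, g • b) = s(x, y) := by
          by_contra hcon
          exact h ⟨hxy, not_exists.mp hcon⟩
        obtain ⟨g, hg⟩ := this
        have hr : (X.replaceGraph a b a' b' hne).Reachable (g • a) (g • b) := by
          have e : (X.replaceGraph a b a' b' hne).Adj (g • a') (g • b') := Or.inr ⟨g, rfl⟩
          exact (((X.cut_reachable_smul a b g ha).mono cutle).trans e.reachable).trans
            ((X.cut_reachable_smul a b g hb).mono cutle).symm
        rw [Sym2.eq_iff] at hg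
        rcases hg with ⟨rfl, rfl⟩ | ⟨rfl, rfl⟩
        · exact hr
        · exact hr.symm
    intro x y
    obtain ⟨p⟩ := X.isTree.connected x y
    induction p with
    | nil => exact SimpleGraph.Reachable.refl _
    | cons h p ih => exact (key _ _ h).trans ih
  · rintro x y (hxy | ⟨g, hg⟩)
    · obtain ⟨χ, hχ⟩ := X.isTree.exists_potential (fun e => if e = s(x, y) then 1 else 0)
      -- The indicator `χ` of the kept edge may jump across new edges. The potential `ψ` keeps the
      -- jumps of `χ` on surviving edges and is given the jump `T g` on the removed edge g(a, b),
      -- chosen so that its jump on g(a', b') vanishes.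
      let T : G → ZMod 2 := fun g => χ (g • a') + χ (g • a) + χ (g • b) + χ (g • b')
      obtain ⟨ψ, hψ⟩ := X.isTree.exists_potential (fun e =>
        if h : ∃ g : G, s(g • a, g • b) = e then T h.choose else if e = s(x, y) then 1 else 0)
      have hcut : ∀ p q, (X.cut a b).Adj p q → ψ p + ψ q = χ p + χ q := by
        intro p q h
        rw [hψ p q h.1, hχ p q h.1, dif_neg (not_exists.mpr h.2)]
      have hreach : ∀ {p q}, (X.cut a b).Reachable p q → ψ p + χ p = ψ q + χ q := fun h =>
        h.apply_eq (χ := fun p => ψ p + χ p) fun p q hpq => by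
          have := hcut p q hpq
          grind
      have hT : ∀ g : G, ψ (g • a) + ψ (g • b) = T g := by
        intro g
        have hex : ∃ k : G, s(k • a, k • b) = s(g • a, g • b) := ⟨g, rfl⟩
        rw [hψ _ _ (X.adj_smul g _ _ hab), dif_pos hex]
        have e := hex.choose_spec
        simp only [T]
        rw [X.smul_eq_smul_of_mk_eq hab hsa e, X.smul_eq_smul_of_mk_eq hab hsb e,
          X.smul_eq_smul_of_mk_eq hab hva e, X.smul_eq_smul_of_mk_eq hab hvb e]
      refine ⟨ψ, fun he => ?_, ?_⟩
      · have := hcut x y hxy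
        rw [hχ x y hxy.1, if_pos rfl, he, CharTwo.add_self_eq_zero] at this
        exact zero_ne_one this
      · rintro p q (hpq | ⟨g, hg⟩) hne'
        · have := hcut p q hpq
          rw [hχ p q hpq.1, if_neg hne'] at this
          exact CharTwo.add_eq_zero.mp this
        · have h1 := hT g
          have h2 := hreach (X.cut_reachable_smul a b g ha)
          have h3 := hreach (X.cut_reachable_smul a b g hb)
          have h4 : ψ (g • a') = ψ (g • b') := by
            simp only [T] at h1
            grind
          rw [Sym2.eq_iff] at hg
          rcases hg with ⟨rfl, rfl⟩ | ⟨rfl, rfl⟩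
          · exact h4
          · exact h4.symm
    · obtain ⟨χ, h1, h2⟩ := X.exists_indicator (g • a) (g • b)
      have hc : ∀ {x y}, (X.cut a b).Reachable x y → χ x = χ y := fun h =>
        h.apply_eq fun x y (hxy : (X.cut a b).Adj x y) => h1 x y hxy.1 (hxy.2 g)
      rw [← hg]
      refine ⟨χ, ?_, ?_⟩
      · have e : χ (g • a') ≠ χ (g • b') := by
          rw [← hc (X.cut_reachable_smul a b g ha), ← hc (X.cut_reachable_smul a b g hb)]
          intro e
          have := h2 _ _ (X.adj_smul g _ _ hab) rfl
          rw [e, CharTwo.add_self_eq_zero] at this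
          exact zero_ne_one this
        rw [Sym2.eq_iff] at hg
        rcases hg with ⟨rfl, rfl⟩ | ⟨rfl, rfl⟩
        · exact e
        · exact e.symm
      · rintro p q (hpq | ⟨k, hk⟩) hne'
        · exact h1 p q hpq.1 (hpq.2 g)
        · have e : χ (k • a') = χ (k • b') := by
            rw [← hc (X.cut_reachable_smul a b k ha), ← hc (X.cut_reachable_smul a b k hb)]
            apply h1 _ _ (X.adj_smul k _ _ hab)
            intro e
            apply hne'
            rw [← hk, X.smul_eq_smul_of_mk_eq hab hsa e, X.smul_eq_smul_of_mk_eq hab hsb e]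
          rw [Sym2.eq_iff] at hk
          rcases hk with ⟨rfl, rfl⟩ | ⟨rfl, rfl⟩
          · exact e
          · exact e.symm

/-- Sliding both ends of an edge orbit. -/
def replaceEdge (hab : X.graph.Adj a b)
    (ha : (X.cut a b).Reachable a a') (hb : (X.cut a b).Reachable b b')
    (hsa : X.edgeStabilizer a b ≤ X.vertexStabilizer a')
    (hsb : X.edgeStabilizer a b ≤ X.vertexStabilizer b') : GTree G where
  V := X.V
  graph := X.replaceGraph a b a' b' (X.ne_of_cut_reachable hab ha hb)
  isTree := X.replaceGraph_isTree hab ha hb hsa hsb _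
  action := X.action
  adj_smul g v w h := by
    rcases h with h | ⟨k, hk⟩
    · exact Or.inl (X.cut_adj_smul a b g h)
    · refine Or.inr ⟨g * k, ?_⟩
      have := congrArg (Sym2.map (fun v => g • v)) hk
      simpa [mul_smul] using this
  no_inversion := X.no_inversion_of_map (X.replaceGraph_isTree hab ha hb hsa hsb _)
    (by
      intro g v w h
      rcases h with h | ⟨k, hk⟩
      · exact Or.inl (X.cut_adj_smul a b g h)
      · refine Or.inr ⟨g * k, ?_⟩
        have := congrArg (Sym2.map (fun v => g • v)) hk
        simpa [mul_smul] using this) id (fun _ _ => rfl) (fun w => ⟨w, fun _ h => h⟩)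

/-- Replacing an edge orbit of a GBS tree gives a GBS tree with at most as many edge orbits. -/
theorem exists_replaceEdge (hX : X.IsGBS) (hab : X.graph.Adj a b)
    (ha : (X.cut a b).Reachable a a') (hb : (X.cut a b).Reachable b b')
    (hsa : X.edgeStabilizer a b ≤ X.vertexStabilizer a')
    (hsb : X.edgeStabilizer a b ≤ X.vertexStabilizer b') :
    ∃ (Y : GTree G) (ι : X.V → Y.V), Function.Bijective ι ∧ (∀ (g : G) v, ι (g • v) = g • ι v) ∧
      Y.IsGBS ∧ Y.numEdgeOrbits ≤ X.numEdgeOrbits ∧ Y.graph.Adj (ι a') (ι b') := by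
  refine ⟨X.replaceEdge hab ha hb hsa hsb, id, Function.bijective_id, fun _ _ => rfl, ?_, ?_,
    Or.inr ⟨1, by simp⟩⟩
  · refine isGBS_of_stabilizer_le hX (fun w => ⟨w, le_rfl⟩) (fun w => ⟨w, le_rfl⟩) ?_
    rintro (w : X.V) (w' : X.V) (h | ⟨g, hg⟩)
    · exact ⟨w, w', h.1, le_rfl⟩
    · have h0 : X.edgeStabilizer (g • a) (g • b) ≤ X.edgeStabilizer (g • a') (g • b') := by
        intro k hk
        have hk' : g⁻¹ * k * g ∈ X.edgeStabilizer a b :=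
          ⟨X.mem_vertexStabilizer_smul.mp hk.1, X.mem_vertexStabilizer_smul.mp hk.2⟩
        exact ⟨X.mem_vertexStabilizer_smul.mpr (hsa hk'),
          X.mem_vertexStabilizer_smul.mpr (hsb hk')⟩
      refine ⟨g • a, g • b, X.adj_smul g _ _ hab, ?_⟩
      rcases (Sym2.eq_iff (α := X.V)).mp hg with ⟨rfl, rfl⟩ | ⟨rfl, rfl⟩
      · exact h0
      · exact h0.trans (X.edgeStabilizer_comm _ _).le
  · refine numEdgeOrbits_le_of_rel (X := X) (Y := X.replaceEdge hab ha hb hsa hsb)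
      (fun e e' => (e = e' ∧ ∀ g : G, s(g • a, g • b) ≠ e) ∨
        ∃ g : G, s(g • a, g • b) = e ∧ s(g • a', g • b') = e') ?_ ?_
    · intro e'
      induction e' using Sym2.ind with
      | _ x y =>
        rintro (h | ⟨g, hg⟩)
        · exact ⟨s(x, y), h.1, Or.inl ⟨rfl, h.2⟩⟩
        · exact ⟨s(g • a, g • b), X.adj_smul g _ _ hab, Or.inr ⟨g, rfl, hg⟩⟩
    · rintro g e e₁ e₂ (⟨rfl, h1⟩ | ⟨k, rfl, rfl⟩) (⟨rfl, h2⟩ | ⟨l, h2, rfl⟩)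
      · exact ⟨g, rfl⟩
      · exfalso
        apply h1 (g⁻¹ * l)
        have := congrArg (Sym2.map (fun v => g⁻¹ • v)) h2
        rw [Sym2.map_map] at this
        simpa [mul_smul, Function.comp_def] using this
      · exact absurd (by simp [mul_smul]) (h2 (g * k))
      · refine ⟨g, ?_⟩
        have e : s(l • a, l • b) = s((g * k) • a, (g * k) • b) := by
          rw [h2]; simp [mul_smul]
        rw [X.smul_eq_smul_of_mk_eq hab hsa e, X.smul_eq_smul_of_mk_eq hab hsb e]
        simp [mul_smul]
        rfl

end Replace

end GTree

/-! ### Equivariant quotients, collapses and folds. -/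

namespace GTree

variable {G : Type u} [Group G] (X : GTree G)

section Image

variable {T : Type u} (φ : X.V → T)

/-- The image of a tree under a map of its vertices, loops being removed. -/
def imageGraph : SimpleGraph (Set.range φ) where
  Adj p q := p ≠ q ∧ ∃ x y, X.graph.Adj x y ∧ φ x = p ∧ φ y = q
  symm := ⟨fun _ _ ⟨h, x, y, hxy, hx, hy⟩ => ⟨h.symm, y, x, hxy.symm, hy, hx⟩⟩
  loopless := ⟨fun _ h => h.1 rfl⟩

/-- A function whose jump across an edge only depends on the image of the edge. -/
def IsCompatible (χ : X.V → ZMod 2) : Prop :=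
  (∀ x y, X.graph.Adj x y → φ x = φ y → χ x = χ y) ∧
  ∀ x y x' y', X.graph.Adj x y → X.graph.Adj x' y' → φ x = φ x' → φ y = φ y' →
    χ x + χ y = χ x' + χ y'

variable {φ}

/-- The indicator of an image edge pulls back to a function on the edges of `X`, whose potential is
compatible. The hypothesis says exactly that such a potential descends to the image, where it
separates the ends of that one edge. -/
theorem imageGraph_isTree
    (hfib : ∀ χ, X.IsCompatible φ χ → ∀ x y, φ x = φ y → χ x = χ y) :
    (X.imageGraph φ).IsTree := by
  classical
  have hne := X.isTree.connected.nonempty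
  have : Nonempty (Set.range φ) := hne.map fun x => ⟨φ x, x, rfl⟩
  refine ⟨⟨?_⟩, SimpleGraph.isAcyclic_of_potential ?_⟩
  · rintro ⟨_, x, rfl⟩ ⟨_, y, rfl⟩
    obtain ⟨p⟩ := X.isTree.connected x y
    induction p with
    | nil => exact SimpleGraph.Reachable.refl _
    | @cons u v _ h p ih =>
      refine SimpleGraph.Reachable.trans ?_ ih
      by_cases e : φ u = φ v
      · have : (⟨φ u, u, rfl⟩ : Set.range φ) = ⟨φ v, v, rfl⟩ := Subtype.ext e
        rw [this]
      · exact SimpleGraph.Adj.reachable ⟨fun h => e (congrArg Subtype.val h), u, v, h, rfl, rfl⟩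
  · rintro p q ⟨hpq, x, y, hxy, hx, hy⟩
    obtain ⟨χ, hχ⟩ := X.isTree.exists_potential
      (fun e => if e.map φ = s(p.1, q.1) then 1 else 0)
    have hcomp : X.IsCompatible φ χ := by
      refine ⟨fun a b hab e => ?_, fun a b a' b' h h' e e' => ?_⟩
      · have := hχ a b hab
        rw [if_neg] at this
        · exact CharTwo.add_eq_zero.mp this
        · rw [Sym2.map_mk, e, Sym2.eq_iff]
          rintro (h | h)
          · exact hpq (Subtype.ext (h.1.symm.trans h.2))
          · exact hpq (Subtype.ext (h.2.symm.trans h.1))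
      · rw [hχ a b h, hχ a' b' h']
        simp only [Sym2.map_mk, e, e']
        congr
    choose r hr using fun p : Set.range φ => p.2
    have hd : ∀ x (p : Set.range φ), φ x = p → χ (r p) = χ x := fun x p h =>
      hfib χ hcomp _ _ ((hr p).trans h.symm)
    refine ⟨fun p => χ (r p), ?_, ?_⟩
    · simp only
      rw [hd x p hx, hd y q hy]
      intro e
      have := hχ x y hxy
      rw [if_pos (by rw [Sym2.map_mk, hx, hy]), e, CharTwo.add_self_eq_zero] at this
      exact zero_ne_one this
    · rintro p' q' ⟨hpq', x', y', hxy', hx', hy'⟩ hne'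
      simp only
      rw [hd x' p' hx', hd y' q' hy']
      have := hχ x' y' hxy'
      rw [if_neg] at this
      · exact CharTwo.add_eq_zero.mp this
      · rw [Sym2.map_mk, hx', hy']
        intro h
        apply hne'
        rw [Sym2.eq_iff] at h ⊢
        simpa [Subtype.ext_iff] using h

variable [MulAction G T]

/-- The action on the image of an equivariant map. -/
@[reducible] def rangeAction (hφ : ∀ (g : G) v, φ (g • v) = g • φ v) : MulAction G (Set.range φ) where
  smul g p := ⟨g • p.1, by obtain ⟨_, x, rfl⟩ := p; exact ⟨g • x, hφ g x⟩⟩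
  one_smul p := Subtype.ext (one_smul G p.1)
  mul_smul g h p := Subtype.ext (mul_smul g h p.1)

/-- The image of a `G`-tree under an equivariant map along whose fibers the tree folds up. -/
def image (hφ : ∀ (g : G) v, φ (g • v) = g • φ v)
    (hfib : ∀ χ, X.IsCompatible φ χ → ∀ x y, φ x = φ y → χ x = χ y)
    (hst : ∀ x : X.V, ∃ v : X.V, ∀ g : G, g • φ x = φ x → g • v = v) : GTree G :=
  letI := rangeAction X hφ
  have hadj : ∀ (g : G) (p q : Set.range φ), (X.imageGraph φ).Adj p q →
      (X.imageGraph φ).Adj (g • p) (g • q) := by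
    rintro g p q ⟨hne, x, y, hxy, hx, hy⟩
    refine ⟨fun h => hne (MulAction.injective g h), g • x, g • y, X.adj_smul g _ _ hxy, ?_, ?_⟩
    · rw [hφ, hx]; rfl
    · rw [hφ, hy]; rfl
  { V := Set.range φ
    graph := X.imageGraph φ
    isTree := X.imageGraph_isTree hfib
    action := rangeAction X hφ
    adj_smul := hadj
    no_inversion := X.no_inversion_of_map (X.imageGraph_isTree hfib) hadj
      (fun x => ⟨φ x, x, rfl⟩) (fun g v => Subtype.ext (hφ g v)) (by
        rintro ⟨_, x, rfl⟩
        obtain ⟨v, hv⟩ := hst x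
        exact ⟨v, fun g hg => hv g (congrArg Subtype.val hg)⟩) }

/-- A surjective equivariant map of `G`-trees that sends edges to edges or vertices and
is surjective on edges. -/
structure IsQuotientMap (Y : GTree G) (π : X.V → Y.V) : Prop where
  surj : Function.Surjective π
  map_smul : ∀ (g : G) v, π (g • v) = g • π v
  adj : ∀ p q, Y.graph.Adj p q ↔ p ≠ q ∧ ∃ x y, X.graph.Adj x y ∧ π x = p ∧ π y = q

variable {X}

theorem IsQuotientMap.numEdgeOrbits_le {Y : GTree G} {π : X.V → Y.V}
    (h : X.IsQuotientMap Y π) : Y.numEdgeOrbits ≤ X.numEdgeOrbits := by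
  refine numEdgeOrbits_le_of_rel (fun e e' => e.map π = e') ?_ ?_
  · intro e'
    induction e' using Sym2.ind with
    | _ p q =>
      intro hpq
      obtain ⟨-, x, y, hxy, rfl, rfl⟩ := (h.adj p q).mp hpq
      exact ⟨s(x, y), hxy, rfl⟩
  · rintro g e _ _ rfl rfl
    refine ⟨g, ?_⟩
    rw [Sym2.map_map, Sym2.map_map]
    congr 1
    funext v
    exact (h.map_smul g v).symm

theorem IsQuotientMap.numEdgeOrbits_lt {Y : GTree G} {π : X.V → Y.V}
    (h : X.IsQuotientMap Y π) [Finite X.EdgeOrbits] {a b : X.V} (hab : X.graph.Adj a b)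
    (he : π a = π b) : Y.numEdgeOrbits < X.numEdgeOrbits := by
  refine numEdgeOrbits_lt_of_rel (fun e e' => e.map π = e' ∧ e' ∈ Y.graph.edgeSet) ?_ ?_ hab ?_
  · intro e'
    induction e' using Sym2.ind with
    | _ p q =>
      intro hpq
      obtain ⟨-, x, y, hxy, rfl, rfl⟩ := (h.adj p q).mp hpq
      exact ⟨s(x, y), hxy, rfl, hpq⟩
  · rintro g e _ _ ⟨rfl, -⟩ ⟨rfl, -⟩
    refine ⟨g, ?_⟩
    rw [Sym2.map_map, Sym2.map_map]
    congr 1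
    funext v
    exact (h.map_smul g v).symm
  · rintro g e' ⟨rfl, h'⟩
    rw [Sym2.map_mk, h.map_smul, h.map_smul, he] at h'
    exact Y.graph.loopless.irrefl _ h'

theorem IsQuotientMap.vertexStabilizer_le {Y : GTree G} {π : X.V → Y.V}
    (h : X.IsQuotientMap Y π) (v : X.V) : X.vertexStabilizer v ≤ Y.vertexStabilizer (π v) := by
  intro g hg
  rw [mem_vertexStabilizer] at *
  rw [← h.map_smul, hg]

theorem IsQuotientMap.isGBS {Y : GTree G} {π : X.V → Y.V} (h : X.IsQuotientMap Y π)
    (hX : X.IsGBS) (hst : ∀ x, ∃ v, Y.vertexStabilizer (π x) ≤ X.vertexStabilizer v) :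
    Y.IsGBS := by
  refine isGBS_of_stabilizer_le hX ?_ ?_ ?_
  · intro w
    obtain ⟨x, rfl⟩ := h.surj w
    exact hst x
  · intro w
    obtain ⟨x, rfl⟩ := h.surj w
    exact ⟨x, h.vertexStabilizer_le x⟩
  · intro w w' hw
    obtain ⟨-, x, y, hxy, rfl, rfl⟩ := (h.adj w w').mp hw
    exact ⟨x, y, hxy, inf_le_inf (h.vertexStabilizer_le x) (h.vertexStabilizer_le y)⟩

variable (X)

theorem exists_image (hφ : ∀ (g : G) v, φ (g • v) = g • φ v)
    (hfib : ∀ χ, X.IsCompatible φ χ → ∀ x y, φ x = φ y → χ x = χ y)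
    (hst : ∀ x : X.V, ∃ v : X.V, ∀ g : G, g • φ x = φ x → g • v = v) :
    ∃ (Y : GTree G) (π : X.V → Y.V), X.IsQuotientMap Y π ∧
      (∀ x y, π x = π y ↔ φ x = φ y) ∧ ∀ x (g : G), g • π x = π x ↔ g • φ x = φ x := by
  refine ⟨X.image hφ hfib hst, fun x => ⟨φ x, x, rfl⟩, ⟨?_, ?_, ?_⟩, ?_, ?_⟩
  · rintro ⟨_, x, rfl⟩
    exact ⟨x, rfl⟩
  · exact fun g v => Subtype.ext (hφ g v)
  · rintro ⟨p, hp⟩ ⟨q, hq⟩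
    refine and_congr_right fun _ => exists_congr fun x => exists_congr fun y =>
      and_congr_right fun _ => and_congr ?_ ?_
    · exact ⟨fun h => Subtype.ext h, fun h => congrArg Subtype.val h⟩
    · exact ⟨fun h => Subtype.ext h, fun h => congrArg Subtype.val h⟩
  · exact fun x y => Subtype.ext_iff
  · exact fun x g => Subtype.ext_iff

/-- Equivariant maps can be changed on one orbit. -/
theorem exists_equivariant_update (ι : X.V → T) (hι : ∀ (g : G) v, ι (g • v) = g • ι v)
    (v : X.V) (t : T) (ht : ∀ g : G, g • v = v → g • t = t) :
    ∃ φ : X.V → T, (∀ (g : G) x, φ (g • x) = g • φ x) ∧ φ v = t ∧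
      ∀ x, (∀ g : G, g • v ≠ x) → φ x = ι x := by
  classical
  have key : ∀ g h : G, g • v = h • v → g • t = h • t := by
    intro g h e
    have := ht (h⁻¹ * g) (by rw [mul_smul, e, inv_smul_smul])
    rwa [mul_smul, inv_smul_eq_iff] at this
  let φ : X.V → T := fun x => if h : ∃ g : G, g • v = x then h.choose • t else ι x
  have h1 : ∀ g : G, φ (g • v) = g • t := by
    intro g
    have hex : ∃ k : G, k • v = g • v := ⟨g, rfl⟩
    simp only [φ]
    rw [dif_pos hex]
    exact key _ _ hex.choose_spec
  have h2 : ∀ x, (∀ g : G, g • v ≠ x) → φ x = ι x := fun x hx => by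
    simp only [φ]
    rw [dif_neg (not_exists.mpr hx)]
  refine ⟨φ, fun g x => ?_, by simpa using h1 1, h2⟩
  by_cases hx : ∃ k : G, k • v = x
  · obtain ⟨k, rfl⟩ := hx
    rw [smul_smul, h1, h1, mul_smul]
  · rw [not_exists] at hx
    rw [h2 x hx, h2, hι]
    intro k hk
    apply hx (g⁻¹ * k)
    rw [mul_smul, hk, inv_smul_smul]

end Image

/-- Collapsing an edge orbit whose stabilizer is the stabilizer of one of its two endpoints. -/
theorem exists_collapse [Finite X.EdgeOrbits] (hX : X.IsGBS) {v w : X.V}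
    (hvw : X.graph.Adj v w) (hle : X.vertexStabilizer v ≤ X.vertexStabilizer w)
    (hw : ∀ g : G, g • v ≠ w) :
    ∃ Y : GTree G, Y.IsGBS ∧ Y.numEdgeOrbits < X.numEdgeOrbits := by
  -- The vertex g • v is moved onto g • w and all other vertices stay, so each vertex is joined to
  -- its image by an edge or equals it.
  obtain ⟨φ, hφ, hv, hx⟩ := X.exists_equivariant_update id (fun _ _ => rfl) v w hle
  have hφφ : ∀ χ, X.IsCompatible φ χ → ∀ x, χ x = χ (φ x) := by
    intro χ hχ x
    by_cases h : ∃ g : G, g • v = x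
    · obtain ⟨g, rfl⟩ := h
      rw [hφ, hv]
      apply hχ.1 _ _ (X.adj_smul g _ _ hvw)
      rw [hφ, hφ, hv, hx w hw, id]
    · rw [hx x (not_exists.mp h), id]
  have hst : ∀ x : X.V, ∃ y : X.V, ∀ g : G, g • φ x = φ x → g • y = y :=
    fun x => ⟨φ x, fun _ h => h⟩
  obtain ⟨Y, π, hπ, h1, h2⟩ := X.exists_image hφ
    (fun χ hχ x y e => by rw [hφφ χ hχ x, hφφ χ hχ y, e]) hst
  refine ⟨Y, hπ.isGBS hX fun x => ⟨φ x, fun g hg => (h2 x g).mp hg⟩, hπ.numEdgeOrbits_lt hvw ?_⟩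
  rw [h1, hv, hx w hw, id]

/-- Folding along an ascending loop. -/
theorem exists_fold (hX : X.IsGBS) {v : X.V} {s : G} (hvs : X.graph.Adj v (s • v))
    {M : Subgroup G} {r : ℕ} (hvM : X.vertexStabilizer v ≤ M)
    (hMr : M ≤ X.vertexStabilizer (s ^ r • v)) (hMs : ∀ h ∈ M, s⁻¹ * h * s ∈ M) :
    ∃ (Y : GTree G) (π : X.V → Y.V), X.IsQuotientMap Y π ∧ Y.IsGBS ∧
      Y.vertexStabilizer (π v) = M ∧
      (∀ x, (∀ g : G, g • v ≠ x) → Y.vertexStabilizer (π x) = X.vertexStabilizer x) ∧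
      (∀ x, π x = π v → ∃ g : G, g • v = x) ∧
      ∀ χ : X.V → ZMod 2, (∀ g : G, χ (g • v) = χ (g • s • v)) → ∀ x y, π x = π y → χ x = χ y := by
  -- The orbit of `v` is replaced by `G ⧸ M`, which gives `v` the stabilizer `M`; the other orbits
  -- are kept in the left summand.
  obtain ⟨φ, hφ, hv, hx⟩ := X.exists_equivariant_update (T := X.V ⊕ G ⧸ M) Sum.inl
    (fun _ _ => rfl) v (Sum.inr ((1 : G) : G ⧸ M)) (by
      intro g hg
      have : g ∈ M := hvM hg
      rw [Sum.smul_inr]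
      congr 1
      change ((g * 1 : G) : G ⧸ M) = _
      rw [QuotientGroup.eq]
      simpa using this)
  have hgv : ∀ g : G, φ (g • v) = Sum.inr (g : G ⧸ M) := by
    intro g
    rw [hφ, hv, Sum.smul_inr]
    change Sum.inr ((g * 1 : G) : G ⧸ M) = _
    rw [mul_one]
  have hfib0 : ∀ χ : X.V → ZMod 2, (∀ (g : G), ∀ h ∈ M, χ (g • v) = χ ((g * h) • v)) →
      ∀ x y, φ x = φ y → χ x = χ y := by
    intro χ hχ x y hxy
    by_cases h1 : ∃ g : G, g • v = x
    · by_cases h2 : ∃ g : G, g • v = y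
      · obtain ⟨g, rfl⟩ := h1
        obtain ⟨k, rfl⟩ := h2
        rw [hgv, hgv, Sum.inr.injEq, QuotientGroup.eq] at hxy
        have := hχ g _ hxy
        rwa [mul_inv_cancel_left] at this
      · obtain ⟨g, rfl⟩ := h1
        rw [hgv, hx y (not_exists.mp h2)] at hxy
        exact absurd hxy (by simp)
    · by_cases h2 : ∃ g : G, g • v = y
      · obtain ⟨g, rfl⟩ := h2
        rw [hgv, hx x (not_exists.mp h1)] at hxy
        exact absurd hxy (by simp)
      · rw [hx x (not_exists.mp h1), hx y (not_exists.mp h2), Sum.inl.injEq] at hxy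
        rw [hxy]
  have hMj : ∀ (j : ℕ), ∀ h ∈ M, (s ^ j)⁻¹ * h * s ^ j ∈ M := by
    intro j
    induction j with
    | zero => intro h hh; simpa using hh
    | succ j ih =>
      intro h hh
      have := hMs _ (ih h hh)
      rwa [pow_succ, mul_inv_rev, show s⁻¹ * (s ^ j)⁻¹ * h * (s ^ j * s) =
        s⁻¹ * ((s ^ j)⁻¹ * h * s ^ j) * s by group]
  have hfib : ∀ χ, X.IsCompatible φ χ → ∀ x y, φ x = φ y → χ x = χ y := by
    intro χ hχ
    apply hfib0
    intro g h hh
    -- The rays g s^j v and g h s^j v have the same image edge by edge, because `M` is stable under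
    -- conjugation by s⁻¹. They meet at j = r, where `h` fixes s^r v. Telescoping the jumps back
    -- from there gives equal values at j = 0.
    have step : ∀ j : ℕ, χ (g • v) + χ ((g * h) • v) =
        χ ((g * s ^ j) • v) + χ ((g * h * s ^ j) • v) := by
      intro j
      induction j with
      | zero => simp
      | succ j ih =>
        have hj := X.adj_smul (g * s ^ j) _ _ hvs
        have hj' := X.adj_smul (g * h * s ^ j) _ _ hvs
        rw [smul_smul, show g * s ^ j * s = g * s ^ (j + 1) by rw [pow_succ, mul_assoc]] at hj
        rw [smul_smul, show g * h * s ^ j * s = g * h * s ^ (j + 1) by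
          rw [pow_succ, mul_assoc _ _ s]] at hj'
        have e : ∀ j : ℕ, φ ((g * s ^ j) • v) = φ ((g * h * s ^ j) • v) := by
          intro j
          rw [hgv, hgv, Sum.inr.injEq, QuotientGroup.eq]
          have := hMj j h hh
          rwa [show (g * s ^ j)⁻¹ * (g * h * s ^ j) = (s ^ j)⁻¹ * h * s ^ j by group]
        have := hχ.2 _ _ _ _ hj hj' (e j) (e (j + 1))
        grind
    have hr := step r
    have : (g * h * s ^ r) • v = (g * s ^ r) • v := by
      rw [mul_smul, mul_smul, hMr hh, mul_smul]
    rw [this, CharTwo.add_self_eq_zero] at hr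
    exact CharTwo.add_eq_zero.mp hr
  have hstv : ∀ g k : G, g • φ (k • v) = φ (k • v) ↔ k⁻¹ * g * k ∈ M := by
    intro g k
    rw [← hφ, smul_smul, hgv, hgv, Sum.inr.injEq, eq_comm, QuotientGroup.eq, mul_assoc]
  have hstx : ∀ x, (∀ g : G, g • v ≠ x) → ∀ g : G, g • φ x = φ x ↔ g • x = x := by
    intro x h g
    rw [hx x h, Sum.smul_inl, Sum.inl.injEq]
  have hst : ∀ x : X.V, ∃ y : X.V, ∀ g : G, g • φ x = φ x → g • y = y := by
    intro x
    by_cases h : ∃ k : G, k • v = x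
    · obtain ⟨k, rfl⟩ := h
      refine ⟨k • s ^ r • v, fun g hg => ?_⟩
      exact X.mem_vertexStabilizer_smul.mpr (hMr ((hstv g k).mp hg))
    · exact ⟨x, fun g => (hstx x (not_exists.mp h) g).mp⟩
  obtain ⟨Y, π, hπ, h1, h2⟩ := X.exists_image hφ hfib hst
  refine ⟨Y, π, hπ, hπ.isGBS hX ?_, ?_, ?_, ?_, ?_⟩
  · intro x
    obtain ⟨y, hy⟩ := hst x
    exact ⟨y, fun g hg => hy g ((h2 x g).mp hg)⟩
  · ext g
    rw [mem_vertexStabilizer, h2]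
    simpa using hstv g 1
  · intro x hx'
    ext g
    rw [mem_vertexStabilizer, h2, hstx x hx', mem_vertexStabilizer]
  · intro x h
    rw [h1] at h
    by_contra hcon
    rw [hx x (not_exists.mp hcon), hv] at h
    exact absurd h (by simp)
  · intro χ hχ x y hxy
    rw [h1] at hxy
    refine hfib0 χ (fun g h hh => ?_) x y hxy
    have step : ∀ (j : ℕ) (g : G), χ (g • v) = χ ((g * s ^ j) • v) := by
      intro j
      induction j with
      | zero => simp
      | succ j ih =>
        intro g
        rw [ih g, hχ, smul_smul, pow_succ, mul_assoc]
    rw [step r g, step r (g * h), mul_smul (g * h), mul_smul g h, hMr hh, mul_smul]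

end GTree

/-! ### Folding along an ascending loop and then sliding. -/

theorem conj_pow_comm {G : Type*} [Group G] (s h : G) (r : ℕ) :
    (s ^ r)⁻¹ * (s⁻¹ * h * s) * s ^ r = s⁻¹ * ((s ^ r)⁻¹ * h * s ^ r) * s := by
  have h1 : s * s ^ r = s ^ r * s := (pow_succ' s r).symm.trans (pow_succ s r)
  have h2 : (s ^ r)⁻¹ * s⁻¹ = s⁻¹ * (s ^ r)⁻¹ := by rw [← mul_inv_rev, ← mul_inv_rev, h1]
  calc (s ^ r)⁻¹ * (s⁻¹ * h * s) * s ^ r = ((s ^ r)⁻¹ * s⁻¹) * h * (s * s ^ r) := by group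
    _ = _ := by rw [h1, h2]; group

namespace GTree

variable {G : Type u} [Group G] (X : GTree G)

theorem pow_smul_cancel {v : X.V} {s : G} (r : ℕ) (h : s • s ^ r • v = s ^ r • v) : s • v = v := by
  rw [smul_smul, ← pow_succ', pow_succ, mul_smul] at h
  exact MulAction.injective _ h

/-- Folding along an ascending loop `(v, s • v)` until the stabilizer of `v` becomes the conjugate by
`s ^ r` of the stabilizer of another edge `(v, b)`. -/
theorem exists_fold_edge (hX : X.IsGBS) {v b : X.V} {s : G} (hvs : X.graph.Adj v (s • v))
    (hvb : X.graph.Adj v b) (hne : ∀ g k : G, s(g • v, g • b) ≠ s(k • v, k • s • v)) {r : ℕ}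
    (hA : ∀ h ∈ X.edgeStabilizer v b, s⁻¹ * h * s ∈ X.edgeStabilizer v b)
    (hB : ∀ h ∈ X.vertexStabilizer v, (s ^ r)⁻¹ * h * s ^ r ∈ X.edgeStabilizer v b) :
    ∃ (Y : GTree G) (π : X.V → Y.V), X.IsQuotientMap Y π ∧ Y.IsGBS ∧
      (∀ h, h ∈ Y.vertexStabilizer (π v) ↔ (s ^ r)⁻¹ * h * s ^ r ∈ X.edgeStabilizer v b) ∧
      (∀ x, (∀ g : G, g • v ≠ x) → Y.vertexStabilizer (π x) = X.vertexStabilizer x) ∧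
      (∀ x, (∀ g : G, g • v ≠ x) → ∀ g : G, g • π v ≠ π x) ∧
      Y.graph.Adj (π v) (π b) ∧
      Y.edgeStabilizer (π v) (π b) ≤ X.edgeStabilizer v b ∧
      ∀ g : G, (Y.cut (π v) (π b)).Adj (g • π v) (g • s • π v) := by
  let M : Subgroup G := (X.edgeStabilizer v b).comap (MulAut.conj (s ^ r)⁻¹).toMonoidHom
  have hM : ∀ h, h ∈ M ↔ (s ^ r)⁻¹ * h * s ^ r ∈ X.edgeStabilizer v b := by
    intro h
    rw [Subgroup.mem_comap]
    change (s ^ r)⁻¹ * h * ((s ^ r)⁻¹)⁻¹ ∈ _ ↔ _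
    rw [inv_inv]
  have hMr : M ≤ X.vertexStabilizer (s ^ r • v) := fun h hh =>
    X.mem_vertexStabilizer_smul.mpr ((hM h).mp hh).1
  have hMs : ∀ h ∈ M, s⁻¹ * h * s ∈ M := by
    intro h hh
    rw [hM] at hh ⊢
    have := hA _ hh
    rwa [conj_pow_comm]
  obtain ⟨Y, π, hπ, hY, hst, hstx, hfib, hχ⟩ :=
    X.exists_fold hX hvs (fun h hh => (hM h).mpr (hB h hh)) hMr hMs
  -- The indicator of k(v, b) does not jump across loop edges, so it descends to the fold. Hence the
  -- fold neither shrinks this edge to a point nor merges it with a loop edge.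
  have hind : ∀ k : G, ∃ χ : X.V → ZMod 2, (∀ x y, π x = π y → χ x = χ y) ∧
      (∀ g : G, χ (g • v) = χ (g • s • v)) ∧ χ (k • v) ≠ χ (k • b) := by
    intro k
    obtain ⟨χ, h1, h2⟩ := X.exists_indicator (k • v) (k • b)
    have h3 : ∀ g : G, χ (g • v) = χ (g • s • v) := fun g =>
      h1 _ _ (X.adj_smul g _ _ hvs) (hne k g)
    refine ⟨χ, hχ χ h3, h3, fun e => ?_⟩
    have := h2 _ _ (X.adj_smul k _ _ hvb) rfl
    rw [e, CharTwo.add_self_eq_zero] at this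
    exact zero_ne_one this
  have hcutX : ∀ g : G, (X.cut v b).Adj (g • v) (g • s • v) := fun g =>
    ⟨X.adj_smul g _ _ hvs, fun k => hne k g⟩
  have hreach : ∀ (j : ℕ) (g : G), (X.cut v b).Reachable (g • v) (g • s ^ j • v) := by
    intro j
    induction j with
    | zero => intro g; simp
    | succ j ih =>
      intro g
      have := ih (g * s)
      rw [mul_smul, mul_smul, smul_smul s, ← pow_succ'] at this
      exact (hcutX g).reachable.trans this
  have hadj : Y.graph.Adj (π v) (π b) := by
    rw [hπ.adj]
    refine ⟨fun e => ?_, v, b, hvb, rfl, rfl⟩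
    obtain ⟨χ, h1, -, h2⟩ := hind 1
    rw [one_smul, one_smul] at h2
    exact h2 (h1 _ _ e)
  refine ⟨Y, π, hπ, hY, fun h => by rw [hst, hM], hstx, fun x hx g hg => ?_, hadj, ?_, fun g => ?_⟩
  · obtain ⟨k, hk⟩ := hfib (g⁻¹ • x) (by rw [hπ.map_smul, ← hg, inv_smul_smul])
    apply hx (g * k)
    rw [mul_smul, hk, smul_inv_smul]
  -- An element fixing the image edge fixes s^r v in `X`, and also `b` or, if b = u v, the vertex u
  -- s^r v. These lie on the two sides of the edge (v, b), being reached along loop edges, so the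
  -- element fixes (v, b).
  · rintro g ⟨h1, h2⟩
    change g ∈ Y.vertexStabilizer (π v) at h1
    change g ∈ Y.vertexStabilizer (π b) at h2
    rw [hst] at h1
    have hr := hreach r 1
    rw [one_smul, one_smul] at hr
    by_cases hb : ∃ u : G, u • v = b
    · obtain ⟨u, rfl⟩ := hb
      rw [hπ.map_smul, mem_vertexStabilizer_smul, hst] at h2
      exact X.mem_edgeStabilizer_of_cut_reachable hvb hr (hreach r u) (hMr h1)
        (X.mem_vertexStabilizer_smul.mpr (hMr h2))
    · rw [hstx b (not_exists.mp hb)] at h2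
      exact X.mem_edgeStabilizer_of_cut_reachable hvb hr (SimpleGraph.Reachable.refl _)
        (hMr h1) h2
  · refine ⟨Y.adj_smul g _ _ ?_, fun k hk => ?_⟩
    · rw [hπ.adj]
      refine ⟨fun e => ?_, v, s • v, hvs, rfl, hπ.map_smul s v⟩
      have hs : s ∈ M := by rw [← hst]; exact e.symm
      exact hvs.ne (X.pow_smul_cancel r (hMr hs)).symm
    · obtain ⟨χ, h1, h3, h2⟩ := hind k
      apply h2
      rw [← hπ.map_smul, ← hπ.map_smul, ← hπ.map_smul, ← hπ.map_smul, ← hπ.map_smul,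
        Sym2.eq_iff] at hk
      rcases hk with ⟨e1, e2⟩ | ⟨e1, e2⟩
      · rw [h1 _ _ e1, h1 _ _ e2, h3]
      · rw [h1 _ _ e1, h1 _ _ e2, h3]

theorem reachable_inv_pow_smul {H : SimpleGraph X.V} {p : X.V} {s : G}
    (h : ∀ g : G, H.Adj (g • p) (g • s • p)) (r : ℕ) : H.Reachable p ((s ^ r)⁻¹ • p) := by
  induction r with
  | zero => simp
  | succ r ih =>
    refine ih.trans (SimpleGraph.Reachable.symm (SimpleGraph.Adj.reachable ?_))
    have := h ((s ^ (r + 1))⁻¹)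
    have e : (s ^ (r + 1))⁻¹ * s = (s ^ r)⁻¹ := by
      rw [pow_succ', mul_inv_rev, inv_mul_cancel_right]
    rwa [smul_smul _ s p, e] at this

theorem vertexStabilizer_eq_of_injective {X Y : GTree G} {ι : X.V → Y.V}
    (hι : Function.Injective ι) (hs : ∀ (g : G) v, ι (g • v) = g • ι v) (v : X.V) :
    Y.vertexStabilizer (ι v) = X.vertexStabilizer v := by
  ext g
  rw [mem_vertexStabilizer, mem_vertexStabilizer, ← hs, hι.eq_iff]

theorem mem_vertexStabilizer_inv_pow_smul {p : X.V} {s : G} {r : ℕ} {D : Subgroup G}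
    (h : ∀ h, h ∈ X.vertexStabilizer p ↔ (s ^ r)⁻¹ * h * s ^ r ∈ D) :
    X.vertexStabilizer ((s ^ r)⁻¹ • p) = D := by
  ext g
  rw [mem_vertexStabilizer_smul, h, inv_inv]
  have : (s ^ r)⁻¹ * (s ^ r * g * (s ^ r)⁻¹) * s ^ r = g := by group
  rw [this]

/-- If a vertex `v` carries an ascending loop and is joined to a vertex of another orbit by an edge
whose stabilizer contains a conjugate of the stabilizer of `v`, then the number of edge orbits can
be reduced. -/
theorem exists_fewer_of_adj [Finite X.EdgeOrbits] (hX : X.IsGBS) {v b : X.V} {s : G}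
    (hvs : X.graph.Adj v (s • v)) (hvb : X.graph.Adj v b) (hb : ∀ g : G, g • v ≠ b) {r : ℕ}
    (hA : ∀ h ∈ X.edgeStabilizer v b, s⁻¹ * h * s ∈ X.edgeStabilizer v b)
    (hB : ∀ h ∈ X.vertexStabilizer v, (s ^ r)⁻¹ * h * s ^ r ∈ X.edgeStabilizer v b) :
    ∃ Y : GTree G, Y.IsGBS ∧ Y.numEdgeOrbits < X.numEdgeOrbits := by
  have hne : ∀ g k : G, s(g • v, g • b) ≠ s(k • v, k • s • v) := by
    intro g k e
    rw [Sym2.eq_iff] at e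
    rcases e with ⟨-, e⟩ | ⟨-, e⟩
    · apply hb (g⁻¹ * (k * s))
      rw [mul_smul, mul_smul, ← e, inv_smul_smul]
    · apply hb (g⁻¹ * k)
      rw [mul_smul, ← e, inv_smul_smul]
  obtain ⟨Y, π, hπ, hY, hst, hstx, horb, hadj, hD, hcut⟩ :=
    X.exists_fold_edge hX hvs hvb hne hA hB
  have hst' := Y.mem_vertexStabilizer_inv_pow_smul hst
  -- The end at `v` slides down the loop to s⁻ʳv, whose stabilizer is now exactly that of the edge
  -- (v, b) of `X`. It is contained in the stabilizer of `b`, so the edge can be collapsed.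
  obtain ⟨Z, ι, hι, hs, hZ, hle, hZadj⟩ := Y.exists_replaceEdge hY hadj
    (Y.reachable_inv_pow_smul hcut r) (SimpleGraph.Reachable.refl _)
    (by rw [hst']; exact hD) inf_le_right
  have hle' := hle.trans hπ.numEdgeOrbits_le
  have : Finite Z.EdgeOrbits := by
    have h : Z.numEdgeOrbits < ⊤ := lt_of_le_of_lt hle' ENat.card_lt_top_of_finite
    exact ENat.card_lt_top.mp h
  obtain ⟨W, hW, hlt⟩ := Z.exists_collapse hZ hZadj (by
    rw [vertexStabilizer_eq_of_injective hι.1 hs, vertexStabilizer_eq_of_injective hι.1 hs, hst',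
      hstx b hb]
    exact inf_le_right) (by
      intro g hg
      rw [← hs, hι.1.eq_iff, smul_smul] at hg
      exact horb b hb _ hg)
  exact ⟨W, hW, hlt.trans_le hle'⟩

/-- Replacing an ascending loop `(v, s • v)` and another loop `(v, u • v)` at the same vertex by
an ascending loop that passes over both. -/
theorem exists_composite_loop (hX : X.IsGBS) {v : X.V} {s u : G}
    (hvs : X.graph.Adj v (s • v)) (hvu : X.graph.Adj v (u • v))
    (hne : ∀ g k : G, s(g • v, g • u • v) ≠ s(k • v, k • s • v)) {r : ℕ}
    (hA : ∀ h ∈ X.edgeStabilizer v (u • v), s⁻¹ * h * s ∈ X.edgeStabilizer v (u • v))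
    (hB : ∀ h ∈ X.vertexStabilizer v, (s ^ r)⁻¹ * h * s ^ r ∈ X.edgeStabilizer v (u • v)) :
    ∃ (Y : GTree G) (v' : Y.V), Y.IsGBS ∧ Y.numEdgeOrbits ≤ X.numEdgeOrbits ∧
      Y.vertexStabilizer v' = X.edgeStabilizer v (u • v) ∧
      Y.graph.Adj v' ((u * s * s ^ r) • v') ∧
      ∀ w, (∀ g : G, g • v ≠ w) → X.vertexStabilizer v ≤ X.vertexStabilizer w →
        ∃ w', (∀ g : G, g • v' ≠ w') ∧ Y.vertexStabilizer v' ≤ Y.vertexStabilizer w' := by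
  obtain ⟨Y, π, hπ, hY, hst, hstx, horb, hadj, hD, hcut⟩ :=
    X.exists_fold_edge hX hvs hvu hne hA hB
  have hst' := Y.mem_vertexStabilizer_inv_pow_smul hst
  have hstMs : ∀ h ∈ Y.vertexStabilizer (π v), s⁻¹ * h * s ∈ Y.vertexStabilizer (π v) := by
    intro h hh
    rw [hst] at hh ⊢
    have := hA _ hh
    rwa [conj_pow_comm]
  have hb' : (Y.cut (π v) (π (u • v))).Reachable (π (u • v)) (u • s • π v) := by
    have := (hcut u).reachable
    rwa [← hπ.map_smul u v] at this
  -- The first end slides to s⁻ʳv as before. The second end slides from u v one step further to u s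
  -- v, so that the exponent of the new loop keeps the factor contributed by `s`.
  obtain ⟨Z, ι, hι, hs, hZ, hle, hZadj⟩ := Y.exists_replaceEdge hY hadj
    (Y.reachable_inv_pow_smul hcut r) hb'
    (by rw [hst']; exact hD) (by
      intro g hg
      have h2 : g ∈ Y.vertexStabilizer (π (u • v)) := hg.2
      rw [hπ.map_smul, mem_vertexStabilizer_smul] at h2
      rw [mem_vertexStabilizer_smul, mem_vertexStabilizer_smul]
      exact hstMs _ h2)
  refine ⟨Z, ι ((s ^ r)⁻¹ • π v), hZ, hle.trans hπ.numEdgeOrbits_le, ?_, ?_, ?_⟩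
  · rw [vertexStabilizer_eq_of_injective hι.1 hs, hst']
  · rwa [← hs, smul_smul, mul_inv_cancel_right, mul_smul]
  · intro w hw hvw
    refine ⟨ι (π w), ?_, ?_⟩
    · intro g hg
      rw [← hs, hι.1.eq_iff, smul_smul] at hg
      exact horb w hw _ hg
    · rw [vertexStabilizer_eq_of_injective hι.1 hs, vertexStabilizer_eq_of_injective hι.1 hs, hst',
        hstx w hw]
      exact inf_le_left.trans hvw

end GTree

/-! ### Infinite cyclic subgroups and exponents. -/

section Cyclic

variable {G : Type*} [Group G]

/-- `c` generates the infinite cyclic subgroup `H`. -/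
structure IsInfGen (H : Subgroup G) (c : G) : Prop where
  eq_zpowers : H = Subgroup.zpowers c
  inj : ∀ i : ℤ, c ^ i = 1 → i = 0

theorem exists_isInfGen {H : Subgroup G} (h1 : IsCyclic H) (h2 : Infinite H) :
    ∃ c, IsInfGen H c := by
  obtain ⟨⟨c, hc⟩, hgen⟩ := h1.exists_generator
  have hH : H = Subgroup.zpowers c := by
    apply le_antisymm
    · intro g hg
      obtain ⟨i, hi⟩ := hgen ⟨g, hg⟩
      exact ⟨i, congrArg Subtype.val hi⟩
    · rw [Subgroup.zpowers_le]
      exact hc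
  refine ⟨c, hH, fun i hi => ?_⟩
  by_contra hne
  have hfin : IsOfFinOrder c := isOfFinOrder_iff_zpow_eq_one.mpr ⟨i, hne, hi⟩
  have := finite_zpowers.mpr hfin
  rw [← hH] at this
  exact this.not_infinite (Set.infinite_coe_iff.mp h2)

namespace IsInfGen

variable {H : Subgroup G} {c : G}

theorem mem_iff (h : IsInfGen H c) {g : G} : g ∈ H ↔ ∃ i : ℤ, c ^ i = g := by
  rw [h.eq_zpowers]; rfl

theorem zpow_mem (h : IsInfGen H c) (i : ℤ) : c ^ i ∈ H := h.mem_iff.mpr ⟨i, rfl⟩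

theorem mem (h : IsInfGen H c) : c ∈ H := by simpa using h.zpow_mem 1

theorem zpow_inj (h : IsInfGen H c) {i j : ℤ} (e : c ^ i = c ^ j) : i = j := by
  have := h.inj (i - j) (by rw [zpow_sub, e, mul_inv_cancel])
  omega

theorem exists_exponent (h : IsInfGen H c) {D : Subgroup G} (hD : D ≤ H) (hinf : Infinite D) :
    ∃ x : ℤ, x ≠ 0 ∧ ∀ i : ℤ, c ^ i ∈ D ↔ x ∣ i := by
  let A : AddSubgroup ℤ :=
    { carrier := {i | c ^ i ∈ D}
      zero_mem' := by simp
      add_mem' := fun {i j} hi hj => by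
        simp only [Set.mem_ofPred_eq] at *
        rw [zpow_add]; exact D.mul_mem hi hj
      neg_mem' := fun {i} hi => by
        simp only [Set.mem_ofPred_eq] at *
        rw [zpow_neg]; exact D.inv_mem hi }
  obtain ⟨x, hx⟩ := Int.subgroup_cyclic A
  have hmem : ∀ i : ℤ, c ^ i ∈ D ↔ x ∣ i := by
    intro i
    change i ∈ A ↔ _
    rw [hx, ← AddSubgroup.zmultiples_eq_closure, Int.mem_zmultiples_iff]
  refine ⟨x, ?_, hmem⟩
  rintro rfl
  obtain ⟨d, hd⟩ := exists_ne (1 : D)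
  obtain ⟨i, hi⟩ := h.mem_iff.mp (hD d.2)
  have := (hmem i).mp (hi ▸ d.2)
  rw [zero_dvd_iff] at this
  rw [this, zpow_zero] at hi
  exact hd (Subtype.ext hi.symm)

theorem sub_isInfGen (h : IsInfGen H c) {D : Subgroup G} (hD : D ≤ H) {x : ℤ} (hx0 : x ≠ 0)
    (hx : ∀ i : ℤ, c ^ i ∈ D ↔ x ∣ i) : IsInfGen D (c ^ x) := by
  refine ⟨?_, fun i hi => ?_⟩
  · ext g
    constructor
    · intro hg
      obtain ⟨i, rfl⟩ := h.mem_iff.mp (hD hg)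
      obtain ⟨j, rfl⟩ := (hx i).mp hg
      exact ⟨j, (zpow_mul c x j).symm⟩
    · rintro ⟨j, rfl⟩
      exact D.zpow_mem ((hx x).mpr dvd_rfl) j
  · rw [← zpow_mul] at hi
    exact (mul_eq_zero.mp (h.inj _ hi)).resolve_left hx0

end IsInfGen

theorem inv_conj_zpow (s c : G) (i : ℤ) : s⁻¹ * c ^ i * s = (s⁻¹ * c * s) ^ i := by
  have := conj_zpow (i := i) (a := s⁻¹) (b := c)
  rw [inv_inv] at this
  exact this.symm

theorem inv_pow_conj {s c : G} {N : ℤ} (h : s⁻¹ * c * s = c ^ N) (r : ℕ) :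
    (s ^ r)⁻¹ * c * s ^ r = c ^ (N ^ r) := by
  induction r with
  | zero => simp
  | succ r ih =>
    rw [pow_succ, mul_inv_rev, show s⁻¹ * (s ^ r)⁻¹ * c * (s ^ r * s) =
      s⁻¹ * ((s ^ r)⁻¹ * c * s ^ r) * s by group, ih, inv_conj_zpow, h, ← zpow_mul, ← pow_succ']

end Cyclic

/-- Supplies the number `r` of turns around the loop after which the conjugated vertex group lies in
an edge group of index `x`. -/
theorem exists_dvd_pow_of_primes_dvd {x N : ℤ} (hx : x ≠ 0)
    (h : ∀ q : ℕ, q.Prime → (q : ℤ) ∣ x → (q : ℤ) ∣ N) : ∃ r : ℕ, x ∣ N ^ r := by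
  have key : ∀ m : ℕ, m ≠ 0 → (∀ q : ℕ, q.Prime → q ∣ m → q ∣ N.natAbs) →
      ∃ r : ℕ, m ∣ N.natAbs ^ r := by
    intro m
    induction m using Nat.recOnMul with
    | zero => exact fun h => absurd rfl h
    | one => exact fun _ _ => ⟨0, one_dvd _⟩
    | prime p hp => exact fun _ h => ⟨1, by simpa using h p hp dvd_rfl⟩
    | mul a b iha ihb =>
      intro h0 h
      obtain ⟨ha, hb⟩ := mul_ne_zero_iff.mp h0
      obtain ⟨r, hr⟩ := iha ha fun q hq hd => h q hq (hd.mul_right b)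
      obtain ⟨t, ht⟩ := ihb hb fun q hq hd => h q hq (hd.mul_left a)
      exact ⟨r + t, by rw [pow_add]; exact mul_dvd_mul hr ht⟩
  obtain ⟨r, hr⟩ := key x.natAbs (Int.natAbs_ne_zero.mpr hx) fun q hq hd =>
    Int.natCast_dvd.mp (h q hq (Int.natCast_dvd.mpr hd))
  exact ⟨r, by rw [← Int.natAbs_dvd_natAbs, Int.natAbs_pow]; exact hr⟩

/-! ### Gaining primes in the exponent of an ascending loop. -/

namespace GTree

variable {G : Type u} [Group G] (X : GTree G)

/-- The fixed point set of an element is convex. -/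
theorem smul_eq_of_mem_path {v w : X.V} {p : X.graph.Walk v w} (hp : p.IsPath) {g : G}
    (hv : g • v = v) (hw : g • w = w) {y : X.V} (hy : y ∈ p.support) : g • y = y := by
  have hex : ∀ a b, g • v = a → g • w = b → ∃ q : X.graph.Walk a b, q.IsPath ∧
      ∀ i, q.getVert i = g • p.getVert i := by
    rintro a b rfl rfl
    exact ⟨p.map (X.smulHom g), hp.map (f := X.smulHom g) (MulAction.injective g),
      fun i => p.getVert_map _ i⟩
  obtain ⟨q, hq, hqv⟩ := hex v w hv hw
  have : q = p := (X.isTree.existsUnique_path v w).unique hq hp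
  obtain ⟨i, rfl, -⟩ := SimpleGraph.Walk.mem_support_iff_exists_getVert.mp hy
  rw [← hqv, this]

variable {X}

/-- An ascending loop at a vertex whose stabilizer is contained in that of a vertex of a
different orbit. -/
structure BadLoop (X : GTree G) (v : X.V) (s c : G) (N : ℤ) : Prop where
  gbs : X.IsGBS
  adj : X.graph.Adj v (s • v)
  gen : IsInfGen (X.vertexStabilizer v) c
  conj : s⁻¹ * c * s = c ^ N
  bad : ∃ w, (∀ g : G, g • v ≠ w) ∧ X.vertexStabilizer v ≤ X.vertexStabilizer w

theorem BadLoop.ne_zero {v : X.V} {s c : G} {N : ℤ} (h : X.BadLoop v s c N) : N ≠ 0 := by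
  rintro rfl
  have := h.conj
  rw [zpow_zero, mul_assoc, inv_mul_eq_one] at this
  have h1 := h.gen.inj 1 (by rw [zpow_one]; exact mul_eq_right.mp this.symm)
  exact one_ne_zero h1

/-- Either the number of edge orbits can be reduced, or the index of the ascending loop can be
made divisible by more primes. -/
theorem BadLoop.exists_improved [Finite X.EdgeOrbits] {v : X.V} {s c : G} {N : ℤ}
    (h : X.BadLoop v s c N) :
    (∃ Y : GTree G, Y.IsGBS ∧ Y.numEdgeOrbits < X.numEdgeOrbits) ∨
    ∃ (Y : GTree G) (v' : Y.V) (s' c' : G) (N' : ℤ), Y.BadLoop v' s' c' N' ∧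
      Y.numEdgeOrbits ≤ X.numEdgeOrbits ∧ N.natAbs.primeFactors ⊂ N'.natAbs.primeFactors ∧
      c' ∈ Subgroup.zpowers c := by
  by_contra hcon
  rw [not_or] at hcon
  obtain ⟨hmin, hmax⟩ := hcon
  have hN := h.ne_zero
  obtain ⟨w, hw, hvw⟩ := h.bad
  obtain ⟨p, hp, -⟩ := X.isTree.existsUnique_path v w
  have hcp : ∀ i, c • p.getVert i = p.getVert i := fun i =>
    X.smul_eq_of_mem_path hp h.gen.mem (hvw h.gen.mem) (p.getVert_mem_support i)
  -- If nothing can be improved, the whole path stays in the orbit of `v`, which is absurd at `w`.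
  -- The exponent `n` is carried along to ensure that the next edge group has an index composed of
  -- primes of `N`.
  have claim : ∀ i, i ≤ p.length → ∃ (g : G) (n : ℤ), g • v = p.getVert i ∧
      g⁻¹ * c * g = c ^ n ∧ ∀ q : ℕ, q.Prime → (q : ℤ) ∣ n → (q : ℤ) ∣ N := by
    intro i
    induction i with
    | zero =>
      refine fun _ => ⟨1, 1, by simp, by simp, fun q hq hd => ?_⟩
      exact absurd (Int.natCast_dvd.mp hd) (by simpa using hq.one_lt.ne')
    | succ i ih =>
      intro hi
      obtain ⟨g, n, hg, hgn, hn⟩ := ih (by omega)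
      obtain ⟨b, hb⟩ : ∃ b, g⁻¹ • p.getVert (i + 1) = b := ⟨_, rfl⟩
      have hb' : p.getVert (i + 1) = g • b := by rw [← hb, smul_inv_smul]
      have hvb : X.graph.Adj v b := by
        rw [← X.adj_smul_iff g, hg, ← hb']
        exact p.adj_getVert_succ (by omega)
      have hDle : X.edgeStabilizer v b ≤ X.vertexStabilizer v := inf_le_left
      obtain ⟨x, hx0, hx⟩ := h.gen.exists_exponent hDle (h.gbs.2 v b hvb).2
      have hxn : x ∣ n := by
        rw [← hx]
        refine ⟨h.gen.zpow_mem n, ?_⟩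
        change c ^ n • b = b
        rw [← hgn, mul_smul, mul_smul, ← hb', hcp, hb]
      obtain ⟨r, hr⟩ := exists_dvd_pow_of_primes_dvd (N := N) hx0
        fun q hq hd => hn q hq (hd.trans hxn)
      have hA : ∀ k ∈ X.edgeStabilizer v b, s⁻¹ * k * s ∈ X.edgeStabilizer v b := by
        intro k hk
        obtain ⟨j, rfl⟩ := h.gen.mem_iff.mp (hDle hk)
        rw [inv_conj_zpow, h.conj, ← zpow_mul, hx]
        exact ((hx j).mp hk).mul_left N
      have hB : ∀ k ∈ X.vertexStabilizer v, (s ^ r)⁻¹ * k * s ^ r ∈ X.edgeStabilizer v b := by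
        intro k hk
        obtain ⟨j, rfl⟩ := h.gen.mem_iff.mp hk
        rw [inv_conj_zpow, inv_pow_conj h.conj, ← zpow_mul, hx]
        exact hr.mul_right j
      by_cases hbo : ∃ u : G, u • v = b
      swap
      · exact absurd (X.exists_fewer_of_adj h.gbs h.adj hvb (not_exists.mp hbo) hA hB) hmin
      obtain ⟨u, rfl⟩ := hbo
      have hcx : c ^ x ∈ X.edgeStabilizer v (u • v) := (hx x).mpr dvd_rfl
      obtain ⟨y, hy⟩ := h.gen.mem_iff.mp (X.mem_vertexStabilizer_smul.mp hcx.2)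
      obtain ⟨t, rfl⟩ := hxn
      refine ⟨g * u, y * t, by rw [mul_smul, hb'], ?_, ?_⟩
      · rw [mul_inv_rev, show u⁻¹ * g⁻¹ * c * (g * u) = u⁻¹ * (g⁻¹ * c * g) * u by group, hgn,
          zpow_mul, inv_conj_zpow, ← hy, ← zpow_mul]
      suffices hyN : ∀ q : ℕ, q.Prime → (q : ℤ) ∣ y → (q : ℤ) ∣ N by
        intro q hq hd
        rcases (Nat.prime_iff_prime_int.mp hq).dvd_mul.mp hd with hd | hd
        · exact hyN q hq hd
        · exact hn q hq (hd.mul_left x)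
      by_cases hne : ∀ k l : G, s(k • v, k • u • v) ≠ s(l • v, l • s • v)
      · obtain ⟨Y, v', hY, hle, hst, hadj, hbad⟩ :=
          X.exists_composite_loop h.gbs h.adj hvb hne hA hB
        obtain ⟨f, hf⟩ := hr
        -- Conjugating c^x successively by u, s and s^r gives the exponents y, yN and yN·N^r; since
        -- N^r = x f, the result is the power f y N of c^x. A prime of `y` not dividing `N` would
        -- thus be gained.
        have hconj : (u * s * s ^ r)⁻¹ * c ^ x * (u * s * s ^ r) = (c ^ x) ^ (f * (y * N)) := by
          rw [show (u * s * s ^ r)⁻¹ * c ^ x * (u * s * s ^ r) =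
            (s ^ r)⁻¹ * (s⁻¹ * (u⁻¹ * c ^ x * u) * s) * s ^ r by group, ← hy, inv_conj_zpow s,
            h.conj, ← zpow_mul, inv_conj_zpow, inv_pow_conj h.conj, ← zpow_mul, ← zpow_mul, hf]
          congr 1
          ring
        have hbl : Y.BadLoop v' (u * s * s ^ r) (c ^ x) (f * (y * N)) := by
          refine ⟨hY, hadj, ?_, hconj, hbad w hw hvw⟩
          rw [hst]
          exact h.gen.sub_isInfGen hDle hx0 hx
        intro q hq hqy
        by_contra hqN
        refine hmax ⟨Y, v', _, _, _, hbl, hle, ?_, ⟨x, rfl⟩⟩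
        rw [Finset.ssubset_iff_of_subset]
        · refine ⟨q, ?_, fun hmem => hqN ?_⟩
          · rw [Nat.mem_primeFactors]
            refine ⟨hq, Int.natCast_dvd.mp ?_, Int.natAbs_ne_zero.mpr hbl.ne_zero⟩
            exact (hqy.mul_right N).mul_left f
          · exact Int.natCast_dvd.mpr (Nat.dvd_of_mem_primeFactors hmem)
        · apply Nat.primeFactors_mono
          · rw [Int.natAbs_dvd_natAbs]
            exact (dvd_mul_left N y).mul_left f
          · exact Int.natAbs_ne_zero.mpr hbl.ne_zero
      -- Here (v, u v) is a translate of the loop edge, so u is s or s⁻¹ multiplied by powers of c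
      -- on both sides. This forces y = N x or x = N y.
      · have hxN : ∀ q : ℕ, q.Prime → (q : ℤ) ∣ x → (q : ℤ) ∣ N := fun q hq hd =>
          hn q hq (hd.mul_right t)
        simp only [not_forall, not_not] at hne
        obtain ⟨k, l, hkl⟩ := hne
        rw [Sym2.eq_iff] at hkl
        rcases hkl with ⟨e1, e2⟩ | ⟨e1, e2⟩
        · have m1 : l⁻¹ * k ∈ X.vertexStabilizer v := by
            rw [mem_vertexStabilizer, mul_smul, e1, inv_smul_smul]
          have m2 : s⁻¹ * (l⁻¹ * k) * u ∈ X.vertexStabilizer v := by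
            rw [mem_vertexStabilizer, mul_smul, mul_smul, mul_smul, e2, inv_smul_smul,
              inv_smul_smul]
          obtain ⟨i₁, hi₁⟩ := h.gen.mem_iff.mp m1
          obtain ⟨i₂, hi₂⟩ := h.gen.mem_iff.mp m2
          have hu : u = c ^ (-i₁) * s * c ^ i₂ := by
            rw [hi₂, zpow_neg, hi₁]; group
          have : c ^ y = c ^ (N * x) := by
            rw [hy, hu]
            calc (c ^ (-i₁) * s * c ^ i₂)⁻¹ * c ^ x * (c ^ (-i₁) * s * c ^ i₂)
                = c ^ (-i₂) * (s⁻¹ * (c ^ i₁ * c ^ x * c ^ (-i₁)) * s) * c ^ i₂ := by group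
              _ = c ^ (-i₂) * (s⁻¹ * c ^ x * s) * c ^ i₂ := by
                rw [← zpow_add, ← zpow_add]; congr 5; ring
              _ = c ^ (N * x) := by
                rw [inv_conj_zpow, h.conj, ← zpow_mul, ← zpow_add, ← zpow_add]
                congr 1; ring
          rw [h.gen.zpow_inj this]
          intro q hq hd
          rcases (Nat.prime_iff_prime_int.mp hq).dvd_mul.mp hd with hd | hd
          · exact hd
          · exact hxN q hq hd
        · have m1 : s⁻¹ * l⁻¹ * k ∈ X.vertexStabilizer v := by
            rw [mem_vertexStabilizer, mul_smul, mul_smul, e1, inv_smul_smul, inv_smul_smul]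
          have m2 : l⁻¹ * k * u ∈ X.vertexStabilizer v := by
            rw [mem_vertexStabilizer, mul_smul, mul_smul, e2, inv_smul_smul]
          obtain ⟨i₁, hi₁⟩ := h.gen.mem_iff.mp m1
          obtain ⟨i₂, hi₂⟩ := h.gen.mem_iff.mp m2
          have hu : u = c ^ (-i₁) * s⁻¹ * c ^ i₂ := by
            rw [hi₂, zpow_neg, hi₁]; group
          have : c ^ x = c ^ (N * y) := by
            have e : s⁻¹ * c ^ y * s = c ^ (N * y) := by
              rw [inv_conj_zpow, h.conj, ← zpow_mul]
            rw [← e, hy, hu]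
            calc c ^ x = c ^ (i₁ + x - i₁) := by congr 1; ring
              _ = c ^ i₁ * c ^ x * c ^ (-i₁) := by rw [← zpow_add, ← zpow_add]; rfl
              _ = s⁻¹ * (s * (c ^ i₁ * c ^ x * c ^ (-i₁)) * s⁻¹) * s := by group
              _ = s⁻¹ * (c ^ i₂ * (c ^ (-i₂) * (s * (c ^ i₁ * c ^ x * c ^ (-i₁)) * s⁻¹) *
                c ^ i₂) * c ^ (-i₂)) * s := by group
              _ = s⁻¹ * (c ^ i₂ * ((c ^ (-i₁) * s⁻¹ * c ^ i₂)⁻¹ * c ^ x *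
                (c ^ (-i₁) * s⁻¹ * c ^ i₂)) * c ^ (-i₂)) * s := by group
              _ = s⁻¹ * ((c ^ (-i₁) * s⁻¹ * c ^ i₂)⁻¹ * c ^ x *
                (c ^ (-i₁) * s⁻¹ * c ^ i₂)) * s := by
                rw [← hu, ← hy, ← zpow_add, ← zpow_add]
                congr 3; ring
          have hxy := h.gen.zpow_inj this
          intro q hq hd
          exact hxN q hq (hxy ▸ hd.mul_left N)
  obtain ⟨g, -, hg, -⟩ := claim p.length le_rfl
  rw [SimpleGraph.Walk.getVert_length] at hg
  exact hw g hg

end GTree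

/-! ### Bounding the primes; minimal trees are fully reduced. -/

namespace GTree

variable {G : Type u} [Group G] {X : GTree G}

theorem IsGBS.exists_pow_mem_of_adj (hX : X.IsGBS) {a b : X.V} (hab : X.graph.Adj a b) :
    ∃ K : ℕ, K ≠ 0 ∧ ∀ h ∈ X.vertexStabilizer a, h ^ K ∈ X.vertexStabilizer b := by
  obtain ⟨c, hc⟩ := exists_isInfGen (hX.1 a).1 (hX.1 a).2
  have hDle : X.edgeStabilizer a b ≤ X.vertexStabilizer a := inf_le_left
  obtain ⟨x, hx0, hx⟩ := hc.exists_exponent hDle (hX.2 a b hab).2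
  refine ⟨x.natAbs, Int.natAbs_ne_zero.mpr hx0, fun h hh => ?_⟩
  obtain ⟨i, rfl⟩ := hc.mem_iff.mp hh
  rw [← zpow_natCast, ← zpow_mul]
  exact ((hx _).mpr ((Int.dvd_natAbs.mpr dvd_rfl).mul_left i)).2

/-- In a GBS tree with finitely many edge orbits the indices of edge stabilizers in vertex
stabilizers are bounded. -/
theorem IsGBS.exists_uniform_pow (hX : X.IsGBS) [Finite X.EdgeOrbits] :
    ∃ K : ℕ, K ≠ 0 ∧ ∀ a b, X.graph.Adj a b → ∀ h ∈ X.vertexStabilizer a,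
      h ^ K ∈ X.vertexStabilizer b := by
  have two : ∀ o : X.EdgeOrbits, ∃ K : ℕ, K ≠ 0 ∧ ∀ a b (hab : X.graph.Adj a b),
      Quotient.mk X.edgeSetoid ⟨s(a, b), hab⟩ = o → ∀ h ∈ X.vertexStabilizer a,
      h ^ K ∈ X.vertexStabilizer b := by
    intro o
    induction o using Quotient.inductionOn with
    | _ e =>
      obtain ⟨e, he⟩ := e
      induction e using Sym2.ind with
      | _ a b =>
        obtain ⟨K₁, h1, hK₁⟩ := hX.exists_pow_mem_of_adj he
        obtain ⟨K₂, h2, hK₂⟩ := hX.exists_pow_mem_of_adj he.symm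
        -- Edge orbits are unoriented, so one exponent has to serve both directions.
        refine ⟨K₁ * K₂, mul_ne_zero h1 h2, fun x y hxy hq h hh => ?_⟩
        obtain ⟨g, hg⟩ := Quotient.exact hq.symm
        simp only [Sym2.map_mk] at hg
        rw [Sym2.eq_iff] at hg
        rcases hg with ⟨rfl, rfl⟩ | ⟨rfl, rfl⟩
        · rw [mem_vertexStabilizer_smul] at hh ⊢
          rw [← zpow_natCast, inv_conj_zpow, zpow_natCast, pow_mul]
          exact Subgroup.pow_mem _ (hK₁ _ hh) _
        · rw [mem_vertexStabilizer_smul] at hh ⊢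
          rw [← zpow_natCast, inv_conj_zpow, zpow_natCast, mul_comm, pow_mul]
          exact Subgroup.pow_mem _ (hK₂ _ hh) _
  have := Fintype.ofFinite X.EdgeOrbits
  choose K h0 hK using two
  refine ⟨∏ o, K o, Finset.prod_ne_zero_iff.mpr fun o _ => h0 o, fun a b hab h hh => ?_⟩
  obtain ⟨t, ht⟩ := Finset.dvd_prod_of_mem K
    (Finset.mem_univ (α := X.EdgeOrbits) (Quotient.mk X.edgeSetoid ⟨s(a, b), hab⟩))
  rw [ht, pow_mul]
  exact Subgroup.pow_mem _ (hK _ a b hab rfl h hh) _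

/-- The power h^q fixes the whole path from `x` to `y`. Moving along it, h^K fixes the next vertex
whenever `h` fixes the current one, and Bézout recovers `h` from h^q and h^K. -/
theorem mem_vertexStabilizer_of_pow_mem {K : ℕ}
    (hK : ∀ a b, X.graph.Adj a b → ∀ h ∈ X.vertexStabilizer a, h ^ K ∈ X.vertexStabilizer b)
    {q : ℕ} (hq : Nat.Coprime q K) {x y : X.V} {h : G} (hx : h ∈ X.vertexStabilizer x)
    (hy : h ^ q ∈ X.vertexStabilizer y) : h ∈ X.vertexStabilizer y := by
  have adj : ∀ a b, X.graph.Adj a b → h ∈ X.vertexStabilizer a → h ^ q ∈ X.vertexStabilizer b →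
      h ∈ X.vertexStabilizer b := by
    intro a b hab h1 h2
    obtain ⟨m, n, e⟩ := Nat.isCoprime_iff_coprime.mpr hq
    have : h = (h ^ q) ^ m * (h ^ K) ^ n := by
      rw [← zpow_natCast, ← zpow_natCast, ← zpow_mul, ← zpow_mul, ← zpow_add, mul_comm (q : ℤ),
        mul_comm (K : ℤ), e, zpow_one]
    rw [this]
    exact Subgroup.mul_mem _ (Subgroup.zpow_mem _ h2 m) (Subgroup.zpow_mem _ (hK a b hab h h1) n)
  obtain ⟨p, hp, -⟩ := X.isTree.existsUnique_path x y
  have hsupp : ∀ z ∈ p.support, h ^ q ∈ X.vertexStabilizer z := fun z hz =>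
    X.smul_eq_of_mem_path hp (Subgroup.pow_mem _ hx q) hy hz
  clear hp hy
  induction p with
  | nil => exact hx
  | cons hadj p ih =>
    refine ih (adj _ _ hadj hx (hsupp _ ?_)) fun z hz => hsupp z ?_
    · simp
    · simp [hz]

/-- Otherwise, writing N = q N', the element s^j c s⁻ʲ raised to N'^j is a q^j-th root of `c`. It
fixes s^j x, hence also `x` because `q` is prime to `K`. So `c` would have q^j-th roots for all j in
the infinite cyclic stabilizer of `x`. -/
theorem dvd_of_inv_conj_eq_zpow (hX : X.IsGBS) {K : ℕ}
    (hK : ∀ a b, X.graph.Adj a b → ∀ h ∈ X.vertexStabilizer a, h ^ K ∈ X.vertexStabilizer b)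
    {x : X.V} {s c : G} {N : ℤ} (hc : c ∈ X.vertexStabilizer x) (hc1 : c ≠ 1)
    (hs : s⁻¹ * c * s = c ^ N) {q : ℕ} (hq : q.Prime) (hqN : (q : ℤ) ∣ N) : q ∣ K := by
  by_contra hqK
  have hcop : Nat.Coprime q K := (Nat.Prime.coprime_iff_not_dvd hq).mpr hqK
  have hpow : ∀ (j : ℕ) (y z : X.V) (h : G), h ∈ X.vertexStabilizer y →
      h ^ (q ^ j) ∈ X.vertexStabilizer z → h ∈ X.vertexStabilizer z := by
    intro j
    induction j with
    | zero => intro y z h _ h2; simpa using h2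
    | succ j ih =>
      intro y z h h1 h2
      rw [pow_succ, pow_mul] at h2
      exact ih y z h h1 (mem_vertexStabilizer_of_pow_mem hK hcop (Subgroup.pow_mem _ h1 _) h2)
  obtain ⟨a, ha⟩ := exists_isInfGen (hX.1 x).1 (hX.1 x).2
  obtain ⟨k, hk⟩ := ha.mem_iff.mp hc
  have hk0 : k ≠ 0 := by
    rintro rfl
    exact hc1 (by rw [← hk, zpow_zero])
  obtain ⟨N', rfl⟩ := hqN
  have hdvd : ∀ j : ℕ, ((q ^ j : ℕ) : ℤ) ∣ k := by
    intro j
    have h1 : s ^ j * c * (s ^ j)⁻¹ ∈ X.vertexStabilizer (s ^ j • x) := by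
      rw [mem_vertexStabilizer_smul]
      simpa [mul_assoc] using hc
    have h2 : ((s ^ j * c * (s ^ j)⁻¹) ^ (N' ^ j)) ^ (q ^ j) = c := by
      rw [← zpow_natCast, ← zpow_mul, conj_zpow, Nat.cast_pow, ← mul_pow, mul_comm N',
        ← inv_pow_conj hs j]
      group
    have h3 := hpow j _ x _ (Subgroup.zpow_mem _ h1 (N' ^ j)) (by rw [h2]; exact hc)
    obtain ⟨l, hl⟩ := ha.mem_iff.mp h3
    rw [← hl, ← zpow_natCast, ← zpow_mul, ← hk] at h2
    exact ⟨l, by rw [← ha.zpow_inj h2, mul_comm]⟩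
  have h1 := Nat.le_of_dvd (Int.natAbs_pos.mpr hk0) (Int.natCast_dvd.mp (hdvd k.natAbs))
  exact absurd h1 (not_le.mpr (Nat.lt_pow_self hq.one_lt))

theorem finite_edgeOrbits_of_le [Finite X.EdgeOrbits] {Y : GTree G}
    (h : Y.numEdgeOrbits ≤ X.numEdgeOrbits) : Finite Y.EdgeOrbits :=
  ENat.card_lt_top.mp (lt_of_le_of_lt h ENat.card_lt_top_of_finite)

/-- A GBS tree with the smallest number of edge orbits is fully reduced. -/
theorem IsGBS.isFullyReduced_of_minimal (hX : X.IsGBS) [Finite X.EdgeOrbits]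
    (hmin : ∀ Y : GTree G, Y.IsGBS → X.numEdgeOrbits ≤ Y.numEdgeOrbits) : X.IsFullyReduced := by
  intro v w hvw
  by_contra hw
  rw [not_exists] at hw
  obtain ⟨p, hp, -⟩ := X.isTree.existsUnique_path v w
  have hvp : ∀ y ∈ p.support, X.vertexStabilizer v ≤ X.vertexStabilizer y := fun y hy g hg =>
    X.smul_eq_of_mem_path hp hg (hvw hg) hy
  obtain ⟨b, hvb, hb⟩ : ∃ b, X.graph.Adj v b ∧ X.vertexStabilizer v ≤ X.vertexStabilizer b := by
    cases p with
    | nil => exact absurd (one_smul G v) (hw 1)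
    | cons hadj p => exact ⟨_, hadj, hvp _ (by simp)⟩
  by_cases hbo : ∃ s : G, s • v = b
  swap
  · obtain ⟨Y, hY, hlt⟩ := X.exists_collapse hX hvb hb (not_exists.mp hbo)
    exact absurd (hmin Y hY) (not_le.mpr hlt)
  obtain ⟨s, rfl⟩ := hbo
  obtain ⟨c, hc⟩ := exists_isInfGen (hX.1 v).1 (hX.1 v).2
  obtain ⟨N, hN⟩ := hc.mem_iff.mp (X.mem_vertexStabilizer_smul.mp (hb hc.mem))
  obtain ⟨K, hK0, hK⟩ := hX.exists_uniform_pow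
  have hprimes : ∀ m : ℕ, ∃ (Y : GTree G) (v' : Y.V) (s' c' : G) (N' : ℤ),
      Y.BadLoop v' s' c' N' ∧ Y.numEdgeOrbits ≤ X.numEdgeOrbits ∧
      c' ∈ X.vertexStabilizer v ∧ m ≤ N'.natAbs.primeFactors.card := by
    intro m
    induction m with
    | zero => exact ⟨X, v, s, c, N, ⟨hX, hvb, hc, hN.symm, w, hw, hvw⟩, le_rfl, hc.mem, Nat.zero_le _⟩
    | succ m ih =>
      obtain ⟨Y, v', s', c', N', hbl, hle, hc', hm⟩ := ih
      have := finite_edgeOrbits_of_le hle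
      rcases hbl.exists_improved with ⟨Z, hZ, hlt⟩ | ⟨Z, v₂, s₂, c₂, N₂, hbl₂, hle₂, hss, hc₂⟩
      · exact absurd (hmin Z hZ) (not_le.mpr (hlt.trans_le hle))
      · refine ⟨Z, v₂, s₂, c₂, N₂, hbl₂, hle₂.trans hle, ?_, ?_⟩
        · exact (Subgroup.zpowers_le.mpr hc') hc₂
        · exact lt_of_le_of_lt hm (Finset.card_lt_card hss)
  obtain ⟨Y, v', s', c', N', hbl, -, hc', hm⟩ := hprimes (K.primeFactors.card + 1)
  -- The loop lives in `Y`, but its relation holds in `G` and c' fixes `v` in the original tree, so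
  -- the primes are bounded by the constant `K` of `X`.
  have hsub : N'.natAbs.primeFactors ⊆ K.primeFactors := by
    intro q hq
    have hqp := Nat.prime_of_mem_primeFactors hq
    refine Nat.mem_primeFactors.mpr ⟨hqp, ?_, hK0⟩
    refine dvd_of_inv_conj_eq_zpow hX hK hc' ?_ hbl.conj hqp
      (Int.natCast_dvd.mpr (Nat.dvd_of_mem_primeFactors hq))
    rintro rfl
    exact one_ne_zero (hbl.gen.inj 1 (one_zpow 1))
  have := Finset.card_le_card hsub
  omega

end GTree

/-! ### Geodesic lines in trees. -/

namespace SimpleGraph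

variable {V : Type*} {T : SimpleGraph V}

/-- In a tree, a path without backtracking is geodesic. -/
theorem IsTree.dist_eq_of_not_backtracking (hT : T.IsTree) {ℓ : ℕ → V}
    (hadj : ∀ n, T.Adj (ℓ n) (ℓ (n + 1))) (hne : ∀ n, ℓ n ≠ ℓ (n + 2)) (n : ℕ) :
    T.dist (ℓ 0) (ℓ n) = n := by
  suffices h : T.dist (ℓ 0) (ℓ n) = n ∧ T.dist (ℓ 0) (ℓ (n + 1)) = n + 1 from h.1
  induction n with
  | zero => exact ⟨dist_self, by simpa using dist_eq_one_iff_adj.mpr (hadj 0)⟩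
  | succ n ih =>
    obtain ⟨ih1, ih2⟩ := ih
    refine ⟨ih2, ?_⟩
    rcases hT.dist_eq_dist_add_one_of_adj (ℓ 0) (hadj (n + 1)) with h | h
    -- If the distance dropped, ℓ n and ℓ (n + 2) would both be the penultimate vertex of the unique
    -- path from ℓ 0 to ℓ (n + 1).
    · exfalso
      have h' : T.dist (ℓ 0) (ℓ (n + 2)) = n := by
        have : T.dist (ℓ 0) (ℓ (n + 1 + 1)) = n := by omega
        exact this
      obtain ⟨p, hp⟩ := hT.connected.exists_walk_length_eq_dist (ℓ 0) (ℓ n)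
      obtain ⟨q, hq⟩ := hT.connected.exists_walk_length_eq_dist (ℓ 0) (ℓ (n + 2))
      have hp' : (p.concat (hadj n)).IsPath := by
        apply Walk.isPath_of_length_eq_dist
        rw [Walk.length_concat, hp, ih1, ih2]
      have hq' : (q.concat (hadj (n + 1)).symm).IsPath := by
        apply Walk.isPath_of_length_eq_dist
        rw [Walk.length_concat, hq, h', ih2]
      have e := (hT.existsUnique_path _ _).unique hp' hq'
      apply hne n
      have := congrArg Walk.penultimate e
      simpa using this
    · omega

/-- A bi-infinite geodesic. -/
def IsGeodesicLine (T : SimpleGraph V) (ℓ : ℤ → V) : Prop :=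
  (∀ n, T.Adj (ℓ n) (ℓ (n + 1))) ∧ ∀ (i : ℤ) (n : ℕ), T.dist (ℓ i) (ℓ (i + n)) = n

theorem IsTree.isGeodesicLine (hT : T.IsTree) {ℓ : ℤ → V}
    (hadj : ∀ n, T.Adj (ℓ n) (ℓ (n + 1))) (hne : ∀ n, ℓ n ≠ ℓ (n + 2)) :
    T.IsGeodesicLine ℓ := by
  refine ⟨hadj, fun i n => ?_⟩
  have := hT.dist_eq_of_not_backtracking (ℓ := fun n : ℕ => ℓ (i + n))
    (fun n => by simpa [add_assoc] using hadj (i + n))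
    (fun n => by simpa [add_assoc] using hne (i + n)) n
  simpa using this

theorem IsGeodesicLine.injective {ℓ : ℤ → V} (h : T.IsGeodesicLine ℓ) : Function.Injective ℓ := by
  have key : ∀ i j : ℤ, i ≤ j → ℓ i = ℓ j → i = j := by
    intro i j hij e
    obtain ⟨n, rfl⟩ := Int.le.dest hij
    have := h.2 i n
    rw [← e, dist_self] at this
    omega
  intro i j e
  rcases le_total i j with hij | hij
  · exact key i j hij e
  · exact (key j i hij e.symm).symm

theorem exists_walk_of_adj {ℓ : ℤ → V} (hadj : ∀ n, T.Adj (ℓ n) (ℓ (n + 1))) (i : ℤ) (n : ℕ) :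
    ∃ p : T.Walk (ℓ i) (ℓ (i + n)), p.length = n ∧ ∀ z ∈ p.support, z ∈ Set.range ℓ := by
  induction n with
  | zero =>
    rw [Nat.cast_zero, add_zero]
    exact ⟨Walk.nil, rfl, fun z hz => ⟨i, by
      rw [Walk.support_nil, List.mem_singleton] at hz; exact hz.symm⟩⟩
  | succ n ih =>
    obtain ⟨p, hp, hs⟩ := ih
    have e : ℓ (i + n + 1) = ℓ (i + (n + 1 : ℕ)) := by push_cast; rw [add_assoc]
    rw [← e]
    refine ⟨p.concat (hadj _), by rw [Walk.length_concat, hp], fun z hz => ?_⟩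
    rw [Walk.support_concat, List.mem_append] at hz
    rcases hz with hz | hz
    · exact hs z hz
    · exact ⟨_, (List.mem_singleton.mp hz).symm⟩

theorem exists_walk_of_adj' {ℓ : ℤ → V} (hadj : ∀ n, T.Adj (ℓ n) (ℓ (n + 1))) (i j : ℤ) :
    ∃ p : T.Walk (ℓ i) (ℓ j), ∀ z ∈ p.support, z ∈ Set.range ℓ := by
  rcases le_total i j with hij | hij
  · obtain ⟨n, rfl⟩ := Int.le.dest hij
    obtain ⟨p, -, hp⟩ := exists_walk_of_adj hadj i n
    exact ⟨p, hp⟩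
  · obtain ⟨n, rfl⟩ := Int.le.dest hij
    obtain ⟨p, -, hp⟩ := exists_walk_of_adj hadj j n
    exact ⟨p.reverse, fun z hz => hp z (by simpa using hz)⟩

/-- In a tree, every walk between two points of a geodesic line passes through the points
between them. -/
theorem IsTree.mem_support_of_isGeodesicLine (hT : T.IsTree) {ℓ : ℤ → V}
    (h : T.IsGeodesicLine ℓ) (i : ℤ) (m n : ℕ) (p : T.Walk (ℓ i) (ℓ (i + m + n))) :
    ℓ (i + m) ∈ p.support := by
  classical
  obtain ⟨q₁, hq₁, -⟩ := exists_walk_of_adj h.1 i m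
  obtain ⟨q₂, hq₂, -⟩ := exists_walk_of_adj h.1 (i + m) n
  have hq : (q₁.append q₂).IsPath := by
    apply Walk.isPath_of_length_eq_dist
    have := h.2 i (m + n)
    push_cast at this
    rw [Walk.length_append, hq₁, hq₂, add_assoc, this]
  have e := (hT.existsUnique_path _ _).unique hq p.bypass_isPath
  apply p.support_bypass_subset_support
  rw [← e, Walk.mem_support_append_iff]
  exact Or.inl q₁.end_mem_support

end SimpleGraph

/-! ### Axes, and the elliptic subgroups common to all GBS trees. -/

namespace GTree

variable {G : Type u} [Group G] {X : GTree G}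

theorem dist_smul (g : G) (v w : X.V) :
    X.graph.dist (g • v) (g • w) = X.graph.dist v w := by
  have hle : ∀ (g : G) (a b : X.V), X.graph.dist (g • a) (g • b) ≤ X.graph.dist a b := by
    intro g a b
    obtain ⟨p, hp⟩ := X.isTree.connected.exists_walk_length_eq_dist a b
    rw [← hp, ← SimpleGraph.Walk.length_map (X.smulHom g) p]
    exact SimpleGraph.dist_le _
  apply le_antisymm (hle g v w)
  simpa using hle g⁻¹ (g • v) (g • w)

theorem zpow_smul_line {b : G} {ℓ : ℤ → X.V} {k : ℤ} (h : ∀ n, b • ℓ n = ℓ (n + k)) (m n : ℤ) :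
    b ^ m • ℓ n = ℓ (n + m * k) := by
  induction m with
  | zero => simp
  | succ m ih =>
    rw [add_comm (m : ℤ), zpow_add, zpow_one, mul_smul, ih, h]
    congr 1; ring
  | pred m ih =>
    rw [sub_eq_add_neg, add_comm, zpow_add, mul_smul, ih, zpow_neg_one, inv_smul_eq_iff, h]
    congr 1; ring

/-- An element without fixed vertex translates a geodesic line. -/
theorem exists_axis {b : G} (hb : ∀ v : X.V, b • v ≠ v) :
    ∃ (ℓ : ℤ → X.V) (k : ℤ), X.graph.IsGeodesicLine ℓ ∧ 0 < k ∧ ∀ n, b • ℓ n = ℓ (n + k) := by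
  have hnonempty := X.isTree.connected.nonempty
  obtain ⟨x, hx⟩ : ∃ x : X.V, ∀ y : X.V, X.graph.dist x (b • x) ≤ X.graph.dist y (b • y) := by
    obtain ⟨x, hx⟩ := Nat.sInf_mem (Set.range_nonempty fun x : X.V => X.graph.dist x (b • x))
    exact ⟨x, fun y => by simp only at hx; rw [hx]; exact Nat.sInf_le ⟨y, rfl⟩⟩
  obtain ⟨p, hpl⟩ := X.isTree.connected.exists_walk_length_eq_dist x (b • x)
  have hp : p.IsPath := SimpleGraph.Walk.isPath_of_length_eq_dist p hpl
  obtain ⟨k, hk⟩ : ∃ k : ℕ, p.length = k := ⟨_, rfl⟩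
  have hk0 : 0 < k := by
    rw [← hk, hpl]
    exact X.isTree.connected.pos_dist_of_ne (hb x).symm
  -- The axis is the concatenation of the translates of a geodesic from `x` to b x, where `x` has
  -- minimal displacement k.
  let ℓ : ℤ → X.V := fun n => b ^ (n / (k : ℤ)) • p.getVert (n % (k : ℤ)).toNat
  have hshift : ∀ n, b • ℓ n = ℓ (n + k) := by
    intro n
    simp only [ℓ]
    rw [Int.add_emod_right, Int.add_ediv_of_dvd_right dvd_rfl, Int.ediv_self (by omega), add_comm,
      zpow_add, zpow_one, mul_smul]
  have h0 : ∀ i : ℕ, i ≤ k → ℓ i = p.getVert i := by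
    intro i hi
    rcases hi.lt_or_eq with h | rfl
    · simp only [ℓ]
      rw [Int.ediv_eq_zero_of_lt (by omega) (by omega), Int.emod_eq_of_lt (by omega) (by omega)]
      simp
    · have := hshift 0
      rw [zero_add] at this
      rw [← this, ← hk, p.getVert_length]
      simp [ℓ]
  have hform : ∀ (m : ℤ) (i : ℤ), ℓ (i + m * k) = b ^ m • ℓ i := fun m i =>
    (zpow_smul_line hshift m i).symm
  have hrep : ∀ n : ℤ, ∃ (m : ℤ) (i : ℕ), i < k ∧ n = i + m * k := by
    intro n
    refine ⟨n / k, (n % k).toNat, ?_, ?_⟩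
    · have := Int.emod_lt_of_pos n (b := k) (by omega)
      omega
    · have h1 := Int.emod_nonneg n (b := k) (by omega)
      rw [Int.toNat_of_nonneg h1, mul_comm]
      exact (Int.emod_add_mul_ediv n k).symm
  have hadj : ∀ n, X.graph.Adj (ℓ n) (ℓ (n + 1)) := by
    intro n
    obtain ⟨m, i, hi, rfl⟩ := hrep n
    rw [add_right_comm, hform, hform, X.adj_smul_iff, h0 i hi.le]
    have := h0 (i + 1) hi
    push_cast at this
    rw [this]
    exact p.adj_getVert_succ (by omega)
  refine ⟨ℓ, k, X.isTree.isGeodesicLine hadj ?_, by omega, hshift⟩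
  intro n
  obtain ⟨m, i, hi, rfl⟩ := hrep n
  rw [add_right_comm, hform, hform]
  intro e
  have e' := MulAction.injective _ e
  clear e
  by_cases h2 : i + 2 ≤ k
  · have h3 := h0 (i + 2) h2
    push_cast at h3
    rw [h0 i hi.le, h3] at e'
    have := hp.getVert_injOn (by simp; omega) (by simp; omega) e'
    omega
  -- Only backtracking at a junction of two translates remains. For k = 1 it would be an inversion;
  -- for k > 1 it would make the displacement of ℓ 1 smaller than the minimum.
  · obtain rfl : k = i + 1 := by omega
    have h3 : ℓ ((i : ℤ) + 2) = b • ℓ 1 := by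
      rw [hshift]; congr 1; push_cast; ring
    rw [h3] at e'
    rcases Nat.eq_zero_or_pos i with rfl | hi0
    · have h4 : ℓ 1 = b • ℓ 0 := by rw [hshift]; congr 1
      have := hadj 0
      refine X.no_inversion b _ _ this ⟨?_, ?_⟩
      · rw [zero_add, h4]
      · rw [zero_add, ← e', Nat.cast_zero]
    · have := hx (ℓ 1)
      rw [← e', ← hpl, hk] at this
      obtain ⟨q, hq, -⟩ := SimpleGraph.exists_walk_of_adj hadj 1 (i - 1)
      have hle := SimpleGraph.dist_le q
      rw [hq, show (1 : ℤ) + (i - 1 : ℕ) = i by omega] at hle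
      omega

/-- A line translated by an element is contained in every line shifted by that element. -/
theorem mem_range_of_translated {h : G} {ℓ ℓ' : ℤ → X.V} (hℓ : X.graph.IsGeodesicLine ℓ)
    (hℓ' : X.graph.IsGeodesicLine ℓ') {K K' : ℤ} (hK : ∀ n, h • ℓ n = ℓ (n + K))
    (hK' : ∀ n, h • ℓ' n = ℓ' (n + K')) (hpos : 0 < K') (n : ℤ) : ℓ' n ∈ Set.range ℓ := by
  classical
  obtain ⟨w, hw⟩ := X.isTree.connected.exists_walk_length_eq_dist (ℓ' n) (ℓ 0)
  -- Translates by powers of `h` of the walk `w` from ℓ' n to ℓ 0 keep its length. Under the powers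
  -- -i and i its starting point moves farther from ℓ' n than that length, so these translates miss
  -- ℓ' n. The detour along ℓ between them must therefore contain ℓ' n.
  obtain ⟨i, hi⟩ : ∃ i : ℕ, i = w.length + 1 := ⟨_, rfl⟩
  obtain ⟨m, hm⟩ := Int.eq_ofNat_of_zero_le (mul_nonneg (Int.natCast_nonneg i) hpos.le)
  have him : i ≤ m := by
    have : (i : ℤ) * 1 ≤ i * K' := mul_le_mul_of_nonneg_left hpos (Int.natCast_nonneg i)
    omega
  have side : ∀ j : ℤ, ∃ q : X.graph.Walk (ℓ' (n + j * K')) (ℓ (j * K)), q.length = w.length := by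
    intro j
    have e1 := zpow_smul_line hK' j n
    have e2 := zpow_smul_line hK j 0
    rw [zero_add] at e2
    rw [← e1, ← e2]
    exact ⟨w.map (X.smulHom (h ^ j)), w.length_map _⟩
  have far : ∀ (j : ℤ) (q : X.graph.Walk (ℓ' (n + j * K')) (ℓ (j * K))), q.length = w.length →
      X.graph.dist (ℓ' (n + j * K')) (ℓ' n) = m → ℓ' n ∉ q.support := by
    intro j q hq hd hmem
    have h1 := SimpleGraph.dist_le (q.takeUntil _ hmem)
    have h2 := q.length_takeUntil_le_length hmem
    omega
  obtain ⟨q₁, hq₁⟩ := side (-i)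
  obtain ⟨q₂, hq₂⟩ := side i
  obtain ⟨q, hq⟩ := SimpleGraph.exists_walk_of_adj' hℓ.1 (-i * K) (i * K)
  have e1 : n + -(i : ℤ) * K' = n - m := by rw [neg_mul, hm]; rfl
  have e2 : n + (i : ℤ) * K' = n - m + m + m := by rw [hm]; simp
  have f1 := far (-i) q₁ hq₁ (by
    have := hℓ'.2 (n - m) m
    rwa [sub_add_cancel, ← e1] at this)
  have f2 := far i q₂ hq₂ (by
    have := hℓ'.2 n m
    rw [SimpleGraph.dist_comm, hm]
    exact this)
  have hmem : ∀ (x y : ℤ), x = n - m → y = n - m + m + m →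
      ∀ p : X.graph.Walk (ℓ' x) (ℓ' y), ℓ' n ∈ p.support := by
    rintro x y rfl rfl p
    have := X.isTree.mem_support_of_isGeodesicLine hℓ' (n - m) m m p
    rwa [congrArg ℓ' (sub_add_cancel n (m : ℤ))] at this
  have := hmem _ _ e1 e2 (q₁.append (q.append q₂.reverse))
  rw [SimpleGraph.Walk.mem_support_append_iff, SimpleGraph.Walk.mem_support_append_iff,
    SimpleGraph.Walk.support_reverse, List.mem_reverse] at this
  rcases this with h | h | h
  · exact absurd h f1
  · exact hq _ h
  · exact absurd h f2

/-- If a power of an element fixes a vertex, so does the element. -/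
theorem exists_fixed_of_zpow {b : G} {p : ℤ} (hp : p ≠ 0) {y : X.V} (hy : b ^ p • y = y) :
    ∃ v : X.V, b • v = v := by
  by_contra hcon
  obtain ⟨ℓ, k, hℓ, hk, hb⟩ := X.exists_axis (not_exists.mp hcon)
  -- Since b^p fixes `y`, the displacement of ℓ 0 under every power of b^p is at most twice its
  -- distance to `y`; on the axis it is at least `i`.
  let i : ℕ := 2 * X.graph.dist (ℓ 0) y + 1
  have hfix : (b ^ p) ^ (i : ℤ) • y = y :=
    Subgroup.zpow_mem (MulAction.stabilizer G y) hy _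
  have h1 : (b ^ p) ^ (i : ℤ) • ℓ 0 = ℓ (p * i * k) := by
    rw [← zpow_mul, zpow_smul_line hb, zero_add]
  have h2 : X.graph.dist (ℓ 0) (ℓ (p * i * k)) ≤ 2 * X.graph.dist (ℓ 0) y := by
    have h3 := X.isTree.connected.dist_triangle (u := ℓ 0) (v := y) (w := ℓ (p * i * k))
    have h4 := dist_smul (X := X) ((b ^ p) ^ (i : ℤ)) y (ℓ 0)
    rw [hfix, h1, SimpleGraph.dist_comm (u := y) (v := ℓ 0)] at h4
    omega
  have h5 : ∀ z : ℤ, X.graph.dist (ℓ 0) (ℓ z) = z.natAbs := by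
    intro z
    rcases Int.natAbs_eq z with h | h
    · have := hℓ.2 0 z.natAbs
      rwa [zero_add, ← h] at this
    · have := hℓ.2 z z.natAbs
      rw [SimpleGraph.dist_comm, show z + z.natAbs = 0 by omega] at this
      exact this
  rw [h5, Int.natAbs_mul, Int.natAbs_mul] at h2
  have hp1 : 1 ≤ p.natAbs := Int.natAbs_pos.mpr hp
  have hk1 : 1 ≤ k.natAbs := Int.natAbs_pos.mpr hk.ne'
  have : i ≤ p.natAbs * i * k.natAbs := by
    calc i = 1 * i * 1 := by ring
      _ ≤ _ := Nat.mul_le_mul (Nat.mul_le_mul_right _ hp1) hk1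
  simp only [Int.natAbs_natCast] at h2
  omega

theorem IsGBS.exists_pow_mem (hX : X.IsGBS) (x y : X.V) {h : G} (hh : h ∈ X.vertexStabilizer x) :
    ∃ p : ℕ, p ≠ 0 ∧ h ^ p ∈ X.vertexStabilizer y := by
  obtain ⟨p⟩ := X.isTree.connected x y
  induction p generalizing h with
  | nil => exact ⟨1, one_ne_zero, by simpa using hh⟩
  | cons hadj p ih =>
    obtain ⟨K, hK0, hK⟩ := hX.exists_pow_mem_of_adj hadj
    obtain ⟨m, hm0, hm⟩ := ih (hK h hh)
    exact ⟨K * m, mul_ne_zero hK0 hm0, by rwa [pow_mul]⟩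

/-- The vertex stabilizers of a GBS tree are elliptic in every non-elementary tree. -/
theorem IsGBS.exists_vertexStabilizer_le {Y : GTree G} (hY : Y.IsGBS) (hX : ¬ X.IsElementary)
    (y : Y.V) : ∃ x : X.V, Y.vertexStabilizer y ≤ X.vertexStabilizer x := by
  obtain ⟨b, hb⟩ := exists_isInfGen (hY.1 y).1 (hY.1 y).2
  by_contra hcon
  rw [not_exists] at hcon
  have hfix : ∀ v : X.V, b • v ≠ v := by
    intro v hv
    apply hcon v
    rw [hb.eq_zpowers, Subgroup.zpowers_le]
    exact hv
  obtain ⟨ℓ, k, hℓ, hk, hbℓ⟩ := X.exists_axis hfix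
  refine hX (Or.inr ⟨ℓ, hℓ.injective, hℓ.1, fun g n => ?_⟩)
  obtain ⟨p, hp0, hp⟩ := hY.exists_pow_mem y (g • y) hb.mem
  rw [mem_vertexStabilizer_smul] at hp
  obtain ⟨q, hq⟩ := hb.mem_iff.mp hp
  have hq0 : q ≠ 0 := by
    rintro rfl
    rw [zpow_zero] at hq
    have : b ^ (p : ℤ) = 1 := by
      rw [zpow_natCast]
      calc b ^ p = g * (g⁻¹ * b ^ p * g) * g⁻¹ := by group
        _ = 1 := by rw [← hq]; group
    exact hp0 (by exact_mod_cast hb.inj _ this)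
  -- The element b^p translates both ℓ and g ℓ, so g ℓ lies in ℓ. Positivity of q is arranged by
  -- inverting both powers.
  have main : ∀ p q : ℤ, 0 < q → b ^ q = g⁻¹ * b ^ p * g → ∃ m, g • ℓ n = ℓ m := by
    intro p q hq hpq
    have hgℓ : X.graph.IsGeodesicLine fun n => g • ℓ n :=
      ⟨fun n => X.adj_smul g _ _ (hℓ.1 n), fun i n => by simpa only [dist_smul] using hℓ.2 i n⟩
    obtain ⟨m, hm⟩ := mem_range_of_translated (h := b ^ p) hℓ hgℓ (K := p * k) (K' := q * k)
      (zpow_smul_line hbℓ p) (fun n => by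
        rw [smul_smul, show b ^ p * g = g * b ^ q by rw [hpq]; group, mul_smul,
          zpow_smul_line hbℓ]) (mul_pos hq hk) n
    exact ⟨m, hm.symm⟩
  rcases lt_or_gt_of_ne hq0 with h | h
  · refine main (-p) (-q) (by omega) ?_
    rw [zpow_neg, hq, zpow_neg, zpow_natCast]
    group
  · exact main p q h (by rw [hq, zpow_natCast])

/-- The vertex stabilizers of a non-elementary GBS tree are elliptic in every GBS tree. -/
theorem IsGBS.exists_vertexStabilizer_le' {Y : GTree G} (hY : Y.IsGBS) (hXG : X.IsGBS)
    (hX : ¬ X.IsElementary) (v : X.V) :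
    ∃ y : Y.V, X.vertexStabilizer v ≤ Y.vertexStabilizer y := by
  obtain ⟨a, ha⟩ := exists_isInfGen (hXG.1 v).1 (hXG.1 v).2
  obtain ⟨y⟩ := Y.isTree.connected.nonempty
  obtain ⟨b, hb⟩ := exists_isInfGen (hY.1 y).1 (hY.1 y).2
  obtain ⟨x, hx⟩ := hY.exists_vertexStabilizer_le hX y
  obtain ⟨c, hc⟩ := exists_isInfGen (hXG.1 x).1 (hXG.1 x).2
  obtain ⟨p, hp0, hp⟩ := hXG.exists_pow_mem v x ha.mem
  obtain ⟨m, hm⟩ := hc.mem_iff.mp hp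
  obtain ⟨j, hj⟩ := hc.mem_iff.mp (hx hb.mem)
  have hj0 : j ≠ 0 := by
    rintro rfl
    have := hb.inj 1 (by rw [zpow_one, ← hj, zpow_zero])
    exact one_ne_zero this
  -- With a^p = c^m and b = c^j, the power a^(pj) equals b^m, which fixes `y`.
  have hfix : a ^ ((p : ℤ) * j) ∈ Y.vertexStabilizer y := by
    rw [zpow_mul, zpow_natCast, ← hm, ← zpow_mul, mul_comm, zpow_mul, hj]
    exact hb.zpow_mem m
  obtain ⟨y', hy'⟩ := exists_fixed_of_zpow (mul_ne_zero (by exact_mod_cast hp0) hj0) hfix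
  refine ⟨y', ?_⟩
  rw [ha.eq_zpowers, Subgroup.zpowers_le]
  exact hy'

/-- The vertices of a fully reduced tree represent maximal elliptic subgroups. -/
theorem IsFullyReduced.exists_injective {Y : GTree G} (hX : X.IsFullyReduced)
    (h1 : ∀ x : X.V, ∃ y : Y.V, X.vertexStabilizer x ≤ Y.vertexStabilizer y)
    (h2 : ∀ y : Y.V, ∃ x : X.V, Y.vertexStabilizer y ≤ X.vertexStabilizer x) :
    ∃ f : X.VertexOrbits → Y.VertexOrbits, Function.Injective f := by
  choose φ hφ using h1
  refine ⟨fun o => Quotient.mk _ (φ (Quotient.out o)), fun o₁ o₂ h => ?_⟩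
  obtain ⟨g, hg⟩ := Quotient.exact h
  simp only at hg
  -- Both representatives, one of them translated by `g`, have stabilizers inside that of this `x`;
  -- full reducedness puts both in its orbit.
  obtain ⟨x, hx⟩ := h2 (φ (Quotient.out o₁))
  have e1 := (hφ (Quotient.out o₁)).trans hx
  have e2 : X.vertexStabilizer (g • Quotient.out o₂) ≤ X.vertexStabilizer x := by
    refine le_trans (fun k hk => ?_) hx
    rw [← hg, mem_vertexStabilizer_smul]
    exact hφ _ (X.mem_vertexStabilizer_smul.mp hk)
  obtain ⟨k₁, hk₁⟩ := hX _ _ e1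
  obtain ⟨k₂, hk₂⟩ := hX _ _ e2
  rw [← Quotient.out_eq o₁, ← Quotient.out_eq o₂]
  refine Quotient.sound ⟨k₁⁻¹ * (k₂ * g), ?_⟩
  simp only
  rw [mul_smul, mul_smul, hk₂, ← hk₁, inv_smul_smul]

end GTree

/-! ### The Euler characteristic of the quotient graph, modulo 2. -/

theorem Module.Finite.of_range_of_ker {K M N : Type*} [Field K] [AddCommGroup M] [Module K M]
    [AddCommGroup N] [Module K N] (f : M →ₗ[K] N) (h1 : Module.Finite K (LinearMap.range f))
    (h2 : Module.Finite K (LinearMap.ker f)) : Module.Finite K M := by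
  rw [Module.finite_def] at *
  refine Submodule.fg_of_fg_map_of_fg_inf_ker f ?_ ?_
  · rw [Submodule.map_top]
    exact (Submodule.fg_top _).mp h1
  · rw [top_inf_eq]
    exact (Submodule.fg_top _).mp h2

theorem finite_of_moduleFinite_fun {ι K : Type*} [Field K] [Finite K]
    (h : Module.Finite K (ι → K)) : Finite ι := by
  classical
  have := Module.finite_of_finite K (M := ι → K)
  refine Finite.of_injective (fun i : ι => (Pi.single i 1 : ι → K)) fun i j hij => ?_
  by_contra hne
  have := congrFun hij i
  simp only at this
  rw [Pi.single_eq_same, Pi.single_eq_of_ne hne] at this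
  exact one_ne_zero this

namespace GTree

variable {G : Type u} [Group G] (X : GTree G)

/-- The homomorphisms to `ZMod 2` that kill the elliptic elements. -/
def ellipticAnnihilator : Submodule (ZMod 2) (G → ZMod 2) where
  carrier := {θ | (∀ g h, θ (g * h) = θ g + θ h) ∧ ∀ v, ∀ g ∈ X.vertexStabilizer v, θ g = 0}
  zero_mem' := ⟨fun _ _ => (add_zero _).symm, fun _ _ _ => rfl⟩
  add_mem' := by
    rintro a b ⟨ha, ha'⟩ ⟨hb, hb'⟩
    refine ⟨fun g h => ?_, fun v g hg => ?_⟩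
    · simp only [Pi.add_apply, ha, hb]; ring
    · simp only [Pi.add_apply, ha' v g hg, hb' v g hg, add_zero]
  smul_mem' := by
    rintro r a ⟨ha, ha'⟩
    refine ⟨fun g h => ?_, fun v g hg => ?_⟩
    · simp only [Pi.smul_apply, ha, smul_add]
    · simp only [Pi.smul_apply, ha' v g hg, smul_zero]

theorem ellipticAnnihilator_le {X Y : GTree G}
    (h : ∀ y : Y.V, ∃ x : X.V, Y.vertexStabilizer y ≤ X.vertexStabilizer x) :
    X.ellipticAnnihilator ≤ Y.ellipticAnnihilator := by
  rintro θ ⟨h1, h2⟩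
  refine ⟨h1, fun y g hg => ?_⟩
  obtain ⟨x, hx⟩ := h y
  exact h2 x g (hx hg)

/-- The functions on vertices whose coboundary is invariant. -/
def invariantPotential : Submodule (ZMod 2) (X.V → ZMod 2) where
  carrier := {χ | ∀ (g : G) x y, X.graph.Adj x y → χ (g • x) + χ (g • y) = χ x + χ y}
  zero_mem' := fun _ _ _ _ => rfl
  add_mem' := by
    intro a b ha hb g x y h
    have h1 := ha g x y h
    have h2 := hb g x y h
    simp only [Pi.add_apply]
    linear_combination h1 + h2
  smul_mem' := by
    intro r a ha g x y h
    simp only [Pi.smul_apply, ← smul_add, ha g x y h]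

/-- The jump of a function across an edge. -/
def jump (χ : X.V → ZMod 2) : Sym2 X.V → ZMod 2 :=
  Sym2.lift ⟨fun x y => χ x + χ y, fun _ _ => add_comm _ _⟩

/-- The coboundary as a function on edge orbits. -/
noncomputable def coboundary : X.invariantPotential →ₗ[ZMod 2] (X.EdgeOrbits → ZMod 2) where
  toFun χ o := X.jump χ.1 (Quotient.out o).1
  map_add' a b := by
    funext o
    simp only [Pi.add_apply]
    induction (Quotient.out o).1 using Sym2.ind with
    | _ x y => simp only [jump, Sym2.lift_mk, Submodule.coe_add, Pi.add_apply]; ring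
  map_smul' r a := by
    funext o
    simp only [Pi.smul_apply, RingHom.id_apply]
    induction (Quotient.out o).1 using Sym2.ind with
    | _ x y => simp only [jump, Sym2.lift_mk, Submodule.coe_smul, Pi.smul_apply, smul_add]

theorem coboundary_apply (χ : X.invariantPotential) {x y : X.V} (h : X.graph.Adj x y) :
    X.coboundary χ (Quotient.mk X.edgeSetoid ⟨s(x, y), h⟩) = χ.1 x + χ.1 y := by
  obtain ⟨g, hg⟩ := Quotient.mk_out (s := X.edgeSetoid) ⟨s(x, y), h⟩
  change X.jump χ.1 (Quotient.out (Quotient.mk X.edgeSetoid ⟨s(x, y), h⟩)).1 = _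
  generalize hq : (Quotient.mk X.edgeSetoid ⟨s(x, y), h⟩).out = q at hg ⊢
  obtain ⟨e, he⟩ := q
  induction e using Sym2.ind with
  | _ a b =>
    have h1 : X.jump χ.1 s(g • a, g • b) = X.jump χ.1 s(x, y) := by
      simp only [Sym2.map_mk] at hg
      rw [hg]
    have h2 := χ.2 g a b he
    simp only [jump, Sym2.lift_mk] at h1 ⊢
    rw [← h1, h2]

theorem apply_eq_of_forall_adj {α : Type*} {χ : X.V → α}
    (h : ∀ x y, X.graph.Adj x y → χ x = χ y) (x y : X.V) : χ x = χ y :=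
  (X.isTree.connected x y).apply_eq h

theorem coboundary_surjective : Function.Surjective X.coboundary := by
  classical
  intro c
  obtain ⟨χ, hχ⟩ := X.isTree.exists_potential
    (fun e => if h : e ∈ X.graph.edgeSet then c (Quotient.mk X.edgeSetoid ⟨e, h⟩) else 0)
  have hval : ∀ x y (h : X.graph.Adj x y),
      χ x + χ y = c (Quotient.mk X.edgeSetoid ⟨s(x, y), h⟩) := by
    intro x y h
    rw [hχ x y h, dif_pos (show s(x, y) ∈ X.graph.edgeSet from h)]
  have hinv : χ ∈ X.invariantPotential := by
    intro g x y h
    rw [hval _ _ (X.adj_smul g _ _ h), hval _ _ h]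
    congr 1
    exact (Quotient.sound ⟨g, rfl⟩ : Quotient.mk X.edgeSetoid ⟨s(x, y), h⟩ = _).symm
  refine ⟨⟨χ, hinv⟩, ?_⟩
  funext o
  induction o using Quotient.inductionOn with
  | _ e =>
    obtain ⟨e, he⟩ := e
    induction e using Sym2.ind with
    | _ x y => rw [X.coboundary_apply ⟨χ, hinv⟩ he, hval x y he]

/-- The constant function. -/
def onePotential : X.invariantPotential := ⟨fun _ => 1, fun _ _ _ _ => rfl⟩

theorem ker_coboundary : LinearMap.ker X.coboundary = Submodule.span (ZMod 2) {X.onePotential} := by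
  obtain ⟨v⟩ := X.isTree.connected.nonempty
  ext χ
  rw [LinearMap.mem_ker, Submodule.mem_span_singleton]
  constructor
  · intro h
    refine ⟨χ.1 v, Subtype.ext (funext fun x => ?_)⟩
    have := X.apply_eq_of_forall_adj (χ := χ.1) (fun x y hxy => by
      have := X.coboundary_apply χ hxy
      rw [h] at this
      exact CharTwo.add_eq_zero.mp this.symm) v x
    simp [onePotential, this]
  · rintro ⟨r, rfl⟩
    rw [map_smul]
    have : X.coboundary X.onePotential = 0 := by
      funext o
      induction o using Quotient.inductionOn with
      | _ e =>
        obtain ⟨e, he⟩ := e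
        induction e using Sym2.ind with
        | _ x y =>
          rw [X.coboundary_apply _ he]
          exact CharTwo.add_self_eq_zero (1 : ZMod 2)
    rw [this, smul_zero]

theorem finrank_ker_coboundary : Module.finrank (ZMod 2) (LinearMap.ker X.coboundary) = 1 := by
  rw [ker_coboundary]
  apply finrank_span_singleton
  obtain ⟨v⟩ := X.isTree.connected.nonempty
  intro h
  exact one_ne_zero (congrFun (congrArg Subtype.val h) v : (1 : ZMod 2) = 0)

/-- The period of an invariant potential. -/
def period (v : X.V) : X.invariantPotential →ₗ[ZMod 2] (G → ZMod 2) where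
  toFun χ g := χ.1 (g • v) + χ.1 v
  map_add' a b := by
    funext g
    simp only [Submodule.coe_add, Pi.add_apply]; ring
  map_smul' r a := by
    funext g
    simp only [Submodule.coe_smul, Pi.smul_apply, smul_add, RingHom.id_apply]

theorem period_eq (χ : X.invariantPotential) (g : G) (v w : X.V) :
    χ.1 (g • v) + χ.1 v = χ.1 (g • w) + χ.1 w :=
  X.apply_eq_of_forall_adj (χ := fun v => χ.1 (g • v) + χ.1 v) (fun x y h => by
    have := χ.2 g x y h
    have h1 := CharTwo.add_self_eq_zero (χ.1 (g • y))
    have h2 := CharTwo.add_self_eq_zero (χ.1 x)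
    linear_combination this - h1 + h2) v w

/-- The period does not depend on the base vertex, so it vanishes on every element that fixes some
vertex. Conversely, a homomorphism killing vertex stabilizers can be integrated over each orbit. -/
theorem range_period (v : X.V) : LinearMap.range (X.period v) = X.ellipticAnnihilator := by
  apply le_antisymm
  · rintro _ ⟨χ, rfl⟩
    refine ⟨fun g h => ?_, fun w g hg => ?_⟩
    · change χ.1 ((g * h) • v) + χ.1 v = χ.1 (g • v) + χ.1 v + (χ.1 (h • v) + χ.1 v)
      rw [X.period_eq χ g v (h • v), mul_smul]
      linear_combination -CharTwo.add_self_eq_zero (χ.1 (h • v))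
    · change χ.1 (g • v) + χ.1 v = 0
      rw [X.period_eq χ g v w, hg, CharTwo.add_self_eq_zero]
  · rintro θ ⟨h1, h2⟩
    have hrep : ∀ x : X.V, ∃ g : G,
        g • (Quotient.mk (MulAction.orbitRel G X.V) x).out = x := by
      intro x
      obtain ⟨g, hg⟩ := Quotient.mk_out (s := MulAction.orbitRel G X.V) x
      exact ⟨g⁻¹, by rw [← hg, inv_smul_smul]⟩
    -- Here γ x carries the orbit representative to `x`. It is unique up to the stabilizer of the
    -- representative, on which θ vanishes, so x ↦ θ (γ x) is the required potential.
    choose γ hγ using hrep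
    have hθ : ∀ g x, θ (γ (g • x)) = θ g + θ (γ x) := by
      intro g x
      have hq : Quotient.mk (MulAction.orbitRel G X.V) (g • x) = Quotient.mk _ x :=
        Quotient.sound ⟨g, rfl⟩
      have e1 := hγ (g • x)
      rw [hq] at e1
      have e2 := h2 (Quotient.mk (MulAction.orbitRel G X.V) x).out
        ((g * γ x)⁻¹ * γ (g • x)) (by
          rw [mem_vertexStabilizer, mul_smul, e1, mul_inv_rev, mul_smul, inv_smul_smul,
            inv_smul_eq_iff, hγ])
      have e3 := h1 (g * γ x) ((g * γ x)⁻¹ * γ (g • x))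
      rwa [mul_inv_cancel_left, e2, add_zero, h1] at e3
    refine ⟨⟨fun x => θ (γ x), fun g x y _ => ?_⟩, funext fun g => ?_⟩
    · change θ (γ (g • x)) + θ (γ (g • y)) = θ (γ x) + θ (γ y)
      rw [hθ, hθ]
      linear_combination CharTwo.add_self_eq_zero (θ g)
    · change θ (γ (g • v)) + θ (γ v) = θ g
      rw [hθ, add_assoc, CharTwo.add_self_eq_zero, add_zero]

/-- Functions on vertex orbits as invariant potentials. -/
def orbitPotential : (X.VertexOrbits → ZMod 2) →ₗ[ZMod 2] X.invariantPotential where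
  toFun f := ⟨fun x => f (Quotient.mk (MulAction.orbitRel G X.V) x), fun g x y _ => by
    have h : ∀ z : X.V, Quotient.mk (MulAction.orbitRel G X.V) (g • z) = Quotient.mk _ z :=
      fun z => Quotient.sound ⟨g, rfl⟩
    exact congrArg₂ (fun a b => f a + f b) (h x) (h y)⟩
  map_add' _ _ := rfl
  map_smul' _ _ := rfl

theorem orbitPotential_injective : Function.Injective X.orbitPotential := by
  intro f₁ f₂ h
  funext o
  induction o using Quotient.inductionOn with
  | _ x => exact congrFun (congrArg Subtype.val h) x

theorem range_orbitPotential (v : X.V) :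
    LinearMap.range X.orbitPotential = LinearMap.ker (X.period v) := by
  ext χ
  rw [LinearMap.mem_ker]
  constructor
  · rintro ⟨f, rfl⟩
    funext g
    change f (Quotient.mk (MulAction.orbitRel G X.V) (g • v)) + f (Quotient.mk _ v) = 0
    rw [(Quotient.sound ⟨g, rfl⟩ :
      Quotient.mk (MulAction.orbitRel G X.V) (g • v) = Quotient.mk _ v)]
    exact CharTwo.add_self_eq_zero _
  · intro h
    have hinv : ∀ (g : G) x, χ.1 (g • x) = χ.1 x := by
      intro g x
      have h1 : χ.1 (g • v) + χ.1 v = 0 := congrFun h g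
      rw [X.period_eq χ g v x] at h1
      exact CharTwo.add_eq_zero.mp h1
    refine ⟨fun o => χ.1 (Quotient.out (s := MulAction.orbitRel G X.V) o),
      Subtype.ext (funext fun x => ?_)⟩
    obtain ⟨g, hg⟩ := Quotient.mk_out (s := MulAction.orbitRel G X.V) x
    change χ.1 (Quotient.mk (MulAction.orbitRel G X.V) x).out = χ.1 x
    rw [← hg]
    exact hinv g x

/-- Invariant potentials are an extension of the annihilator by functions on vertex orbits, and they
surject onto functions on edge orbits. -/
theorem finite_edgeOrbits_of_finite (hV : Finite X.VertexOrbits)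
    (hH : Module.Finite (ZMod 2) X.ellipticAnnihilator) : Finite X.EdgeOrbits := by
  obtain ⟨v⟩ := X.isTree.connected.nonempty
  have hP : Module.Finite (ZMod 2) X.invariantPotential := by
    refine Module.Finite.of_range_of_ker (X.period v) ?_ ?_
    · rwa [range_period]
    · rw [← range_orbitPotential]
      infer_instance
  exact finite_of_moduleFinite_fun (Module.Finite.of_surjective _ X.coboundary_surjective)

/-- The Euler characteristic of the quotient graph. -/
theorem card_edgeOrbits_add_one (hE : Finite X.EdgeOrbits) :
    Finite X.VertexOrbits ∧ Module.Finite (ZMod 2) X.ellipticAnnihilator ∧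
    Nat.card X.EdgeOrbits + 1 =
      Module.finrank (ZMod 2) X.ellipticAnnihilator + Nat.card X.VertexOrbits := by
  obtain ⟨v⟩ := X.isTree.connected.nonempty
  have hP : Module.Finite (ZMod 2) X.invariantPotential := by
    refine Module.Finite.of_range_of_ker X.coboundary inferInstance ?_
    exact Module.finite_of_finrank_eq_succ X.finrank_ker_coboundary
  have hV : Finite X.VertexOrbits :=
    finite_of_moduleFinite_fun (Module.Finite.of_injective _ X.orbitPotential_injective)
  have := Fintype.ofFinite X.EdgeOrbits
  have := Fintype.ofFinite X.VertexOrbits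
  -- The dimension of the space of invariant potentials is counted twice: by the coboundary, with
  -- the constants as kernel, and by the period, with functions on vertex orbits as kernel.
  have e1 := LinearMap.finrank_range_add_finrank_ker X.coboundary
  have e2 := LinearMap.finrank_range_add_finrank_ker (X.period v)
  rw [LinearMap.range_eq_top.mpr X.coboundary_surjective, finrank_top,
    Module.finrank_fintype_fun_eq_card, finrank_ker_coboundary] at e1
  rw [← range_orbitPotential, LinearMap.finrank_range_of_inj X.orbitPotential_injective,
    Module.finrank_fintype_fun_eq_card, range_period] at e2
  refine ⟨hV, ?_, ?_⟩
  · rw [← X.range_period v]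
    infer_instance
  · rw [Nat.card_eq_fintype_card, Nat.card_eq_fintype_card, e1, e2]

end GTree

/-! ### Comparison of edge counts and the theorem. -/

namespace GTree

variable {G : Type u} [Group G] {X : GTree G}

/-- Two trees with the same elliptic vertex stabilizers have the same annihilator. -/
theorem ellipticAnnihilator_eq {X Y : GTree G}
    (h1 : ∀ x : X.V, ∃ y : Y.V, X.vertexStabilizer x ≤ Y.vertexStabilizer y)
    (h2 : ∀ y : Y.V, ∃ x : X.V, Y.vertexStabilizer y ≤ X.vertexStabilizer x) :
    X.ellipticAnnihilator = Y.ellipticAnnihilator :=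
  le_antisymm (ellipticAnnihilator_le h2) (ellipticAnnihilator_le h1)

/-- A fully reduced tree has at most as many edge orbits as any tree with the same elliptic
subgroups. -/
theorem IsFullyReduced.numEdgeOrbits_le {X Y : GTree G} (hX : X.IsFullyReduced)
    (h1 : ∀ x : X.V, ∃ y : Y.V, X.vertexStabilizer x ≤ Y.vertexStabilizer y)
    (h2 : ∀ y : Y.V, ∃ x : X.V, Y.vertexStabilizer y ≤ X.vertexStabilizer x) :
    X.numEdgeOrbits ≤ Y.numEdgeOrbits := by
  rcases finite_or_infinite Y.EdgeOrbits with hY | hY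
  -- Finiteness passes from `Y` to `X` through the vertex orbits and the common annihilator; after
  -- that the two Euler characteristic formulas can be subtracted.
  · obtain ⟨f, hf⟩ := hX.exists_injective h1 h2
    obtain ⟨hYV, hH, hYE⟩ := Y.card_edgeOrbits_add_one hY
    have hXV : Finite X.VertexOrbits := Finite.of_injective f hf
    rw [← ellipticAnnihilator_eq h1 h2] at hH hYE
    have hXfin := X.finite_edgeOrbits_of_finite hXV hH
    obtain ⟨-, -, hXE⟩ := X.card_edgeOrbits_add_one hXfin
    have hcard := Nat.card_le_card_of_injective f hf
    unfold numEdgeOrbits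
    rw [ENat.card_eq_coe_natCard, ENat.card_eq_coe_natCard, Nat.cast_le]
    omega
  · unfold numEdgeOrbits
    rw [ENat.card_eq_top_of_infinite (α := Y.EdgeOrbits)]
    exact le_top

end GTree

theorem mainTheorem6 {G : Type u} [Group G] (X : GTree G) (hGBS : X.IsGBS)
    (hcoc : X.IsCocompact) (hne : ¬ X.IsElementary) :
    (X.IsFullyReduced ↔ ∀ Y : GTree G, Y.IsGBS → X.numEdgeOrbits ≤ Y.numEdgeOrbits) ∧
    (∀ Y Z : GTree G, Y.IsGBS → Z.IsGBS → Y.IsFullyReduced → Z.IsFullyReduced →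
      Y.numEdgeOrbits = Z.numEdgeOrbits) := by
  have hfin := hcoc.2
  have toX : ∀ Y : GTree G, Y.IsGBS → ∀ y : Y.V, ∃ x : X.V,
      Y.vertexStabilizer y ≤ X.vertexStabilizer x := fun Y hY y =>
    hY.exists_vertexStabilizer_le hne y
  have ofX : ∀ Y : GTree G, Y.IsGBS → ∀ x : X.V, ∃ y : Y.V,
      X.vertexStabilizer x ≤ Y.vertexStabilizer y := fun Y hY x =>
    hY.exists_vertexStabilizer_le' hGBS hne x
  have between : ∀ Y Z : GTree G, Y.IsGBS → Z.IsGBS → ∀ y : Y.V, ∃ z : Z.V,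
      Y.vertexStabilizer y ≤ Z.vertexStabilizer z := by
    intro Y Z hY hZ y
    obtain ⟨x, hx⟩ := toX Y hY y
    obtain ⟨z, hz⟩ := ofX Z hZ x
    exact ⟨z, hx.trans hz⟩
  refine ⟨⟨fun hX Y hY => hX.numEdgeOrbits_le (ofX Y hY) (toX Y hY),
    fun hmin => hGBS.isFullyReduced_of_minimal hmin⟩, fun Y Z hY hZ hYr hZr => ?_⟩
  exact le_antisymm (hYr.numEdgeOrbits_le (between Y Z hY hZ) (between Z Y hZ hY))
    (hZr.numEdgeOrbits_le (between Z Y hZ hY) (between Y Z hY hZ))
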